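/- Let $\mathcal H_A,\mathcal H_B$ be finite-dimensional complex Hilbert spaces with fixed reference orthonormal bases, and equip $\mathcal H_A\otimes\mathcal H_B$ with the product basis. For a bipartite state (density operator) $\rho$ on $\mathcal H_A\otimes\mathcal H_B$ let $\rho^{T_A}$ be its partial transpose with respect to $A$, let $\mathcal N(\rho)=\operatorname{tr}|\rho^{T_A}|-1$ be its negativity, and let $C_{l_1}(\rho)=\sum_{x\neq y}|\rho_{xy}|$ be its $l_1$-norm of coherence in the product basis. Call $\rho$ a pairing state if $\mathcal N(\rho)=C_{l_1}(U\rho U^\dagger)$ for some local unitary $U=U_A\otimes U_B$. Call $\rho$ entangled if it is not a convex combination of product states $\alpha\otimes\beta$, NPT if $\rho^{T_A}$ is not positive semidefinite, and distillable if its distillable entanglement is positive, i.e. if there is a rate $R>0$ such that for every $\varepsilon>0$ and all sufficiently large $n$ there are an integer $K\ge 2^{Rn}$ and a deterministic finite-round protocol $\Lambda$ of local operations and classical communication, mapping states on $\mathcal H_A^{\otimes n}\otimes\mathcal H_B^{\otimes n}$ to states on $\mathbb C^K\otimes\mathbb C^K$, with $\langle\Phi_K|\Lambda(\rho^{\otimes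 n})|\Phi_K\rangle\ge 1-\varepsilon$, where $|\Phi_K\rangle=K^{-1/2}\sum_{j=1}^K|jj\rangle$. Theorem. Every entangled pairing state $\rho$ on $\mathcal H_A\otimes\mathcal H_B$ is NPT and distillable. -/

import Mathlib

open scoped Matrix Kronecker ComplexOrder

namespace Bipartite

noncomputable section

/-- A quantum state (density matrix), written in the reference orthonormal basis indexed by `S`. -/
structure IsState {S : Type} [Fintype S] (ρ : Matrix S S ℂ) : Prop where
  posSemidef : ρ.PosSemidef
  trace_eq_one : ρ.trace = 1

/-- Separable: a finite convex combination of products of local states. -/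
def IsSeparable {A B : Type} [Fintype A] [Fintype B] (ρ : Matrix (A × B) (A × B) ℂ) : Prop :=
  ρ ∈ convexHull ℝ {τ : Matrix (A × B) (A × B) ℂ |
    ∃ (α : Matrix A A ℂ) (β : Matrix B B ℂ), IsState α ∧ IsState β ∧ τ = α ⊗ₖ β}

/-- A bipartite state that is not separable. -/
def IsEntangled {A B : Type} [Fintype A] [Fintype B] (ρ : Matrix (A × B) (A × B) ℂ) : Prop :=
  IsState ρ ∧ ¬ IsSeparable ρ

/-- Partial transpose with respect to the subsystem `A`. -/
def partialTransposeA {A B : Type} (ρ : Matrix (A × B) (A × B) ℂ) : Matrix (A × B) (A × B) ℂ :=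
  Matrix.of fun x y => ρ (y.1, x.2) (x.1, y.2)

/-- Negative partial transpose: `ρ^{T_A}` is not positive semidefinite. -/
def IsNPT {A B : Type} (ρ : Matrix (A × B) (A × B) ℂ) : Prop :=
  ¬ (partialTransposeA ρ).PosSemidef

open scoped MatrixOrder Matrix.Norms.L2Operator in
/-- The trace norm `tr |M|`, where `|M|` is the positive square root of `Mᴴ M`. -/
def traceNorm {S : Type} [Fintype S] [DecidableEq S] (M : Matrix S S ℂ) : ℝ :=
  (CFC.abs M).trace.re

/-- The negativity `tr |ρ^{T_A}| - 1`. -/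
def negativity {A B : Type} [Fintype A] [Fintype B] [DecidableEq A] [DecidableEq B]
    (ρ : Matrix (A × B) (A × B) ℂ) : ℝ :=
  traceNorm (partialTransposeA ρ) - 1

/-- The `l₁`-norm of coherence: the sum of the moduli of the off-diagonal entries. -/
def l1Coherence {S : Type} [Fintype S] [DecidableEq S] (ρ : Matrix S S ℂ) : ℝ :=
  ∑ j, ∑ k, if j ≠ k then ‖ρ j k‖ else 0

/-- A pairing state: a state with `𝒩(ρ) = C_{l₁}(U ρ Uᴴ)` for some local unitary
`U = U_A ⊗ U_B`. -/
def IsPairing {A B : Type} [Fintype A] [Fintype B] [DecidableEq A] [DecidableEq B]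
    (ρ : Matrix (A × B) (A × B) ℂ) : Prop :=
  IsState ρ ∧ ∃ UA ∈ Matrix.unitaryGroup A ℂ, ∃ UB ∈ Matrix.unitaryGroup B ℂ,
    negativity ρ = l1Coherence ((UA ⊗ₖ UB) * ρ * (UA ⊗ₖ UB)ᴴ)

/-- Deterministic transformations implementable by finitely many rounds of local operations and
classical communication. A protocol either stops, or one party performs a local measurement with
Kraus operators `K i`, where `∑ i, (K i)ᴴ * K i = 1`, announces the outcome `i`, and the parties go
on with a protocol that may depend on `i`. The dimension of the measured system may change,
depending on the outcome, so local ancillas and local partial traces are included;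
an instrument with several Kraus operators for one outcome is obtained by
continuing in the same way after each of them. -/
inductive IsLOCC {C D : Type} : {A B : Type} →
    (Matrix (A × B) (A × B) ℂ → Matrix (C × D) (C × D) ℂ) → Prop
  | finish : IsLOCC (A := C) (B := D) fun X => X
  | alice {A B ι : Type} {E : ι → Type} [Fintype A] [Fintype B] [DecidableEq A] [DecidableEq B]
      [Fintype ι] [∀ i, Fintype (E i)]
      (K : ∀ i, Matrix (E i) A ℂ) (hK : ∑ i, (K i)ᴴ * K i = 1)
      (Λ : ∀ i, Matrix (E i × B) (E i × B) ℂ → Matrix (C × D) (C × D) ℂ)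
      (hΛ : ∀ i, IsLOCC (Λ i)) :
      IsLOCC fun X : Matrix (A × B) (A × B) ℂ =>
        ∑ i, Λ i ((K i ⊗ₖ (1 : Matrix B B ℂ)) * X * (K i ⊗ₖ (1 : Matrix B B ℂ))ᴴ)
  | bob {A B ι : Type} {E : ι → Type} [Fintype A] [Fintype B] [DecidableEq A] [DecidableEq B]
      [Fintype ι] [∀ i, Fintype (E i)]
      (K : ∀ i, Matrix (E i) B ℂ) (hK : ∑ i, (K i)ᴴ * K i = 1)
      (Λ : ∀ i, Matrix (A × E i) (A × E i) ℂ → Matrix (C × D) (C × D) ℂ)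
      (hΛ : ∀ i, IsLOCC (Λ i)) :
      IsLOCC fun X : Matrix (A × B) (A × B) ℂ =>
        ∑ i, Λ i (((1 : Matrix A A ℂ) ⊗ₖ K i) * X * ((1 : Matrix A A ℂ) ⊗ₖ K i)ᴴ)

/-- The `n`-copy state `ρ^{⊗ n}`, as a bipartite state between `Aⁿ` and `Bⁿ`. -/
def copies {A B : Type} (ρ : Matrix (A × B) (A × B) ℂ) (n : ℕ) :
    Matrix ((Fin n → A) × (Fin n → B)) ((Fin n → A) × (Fin n → B)) ℂ :=
  Matrix.of fun x y => ∏ t, ρ (x.1 t, x.2 t) (y.1 t, y.2 t)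

/-- The maximally entangled unit vector `K^{-1/2} ∑ j, |j j⟩` of local dimension `K`. -/
def maxEntangled (K : ℕ) : Fin K × Fin K → ℂ :=
  fun x => if x.1 = x.2 then (((√(K : ℝ))⁻¹ : ℝ) : ℂ) else 0

/-- The fidelity `⟨Φ_K| σ |Φ_K⟩` of `σ` with the maximally entangled state. -/
def maxEntangledFidelity {K : ℕ} (σ : Matrix (Fin K × Fin K) (Fin K × Fin K) ℂ) : ℝ :=
  (star (maxEntangled K) ⬝ᵥ (σ *ᵥ maxEntangled K)).re

/-- `R` is an achievable rate (in ebits per copy) of entanglement distillation: from `n` copies of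
`ρ`, LOCC produces a maximally entangled state of local dimension at least `2 ^ (R n)`, with
fidelity tending to one as `n → ∞`. -/
def IsDistillationRate {A B : Type} (ρ : Matrix (A × B) (A × B) ℂ) (R : ℝ) : Prop :=
  ∀ ε : ℝ, 0 < ε → ∀ᶠ n : ℕ in Filter.atTop, ∃ K : ℕ, (2 : ℝ) ^ (R * n) ≤ K ∧
    ∃ Λ : Matrix ((Fin n → A) × (Fin n → B)) ((Fin n → A) × (Fin n → B)) ℂ →
        Matrix (Fin K × Fin K) (Fin K × Fin K) ℂ,
      IsLOCC Λ ∧ 1 - ε ≤ maxEntangledFidelity (Λ (copies ρ n))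

/-- Distillable: some positive rate is achievable, i.e. the distillable entanglement (the supremum
of the achievable rates) is positive. -/
def IsDistillable {A B : Type} (ρ : Matrix (A × B) (A × B) ℂ) : Prop :=
  ∃ R : ℝ, 0 < R ∧ IsDistillationRate ρ R

end

end Bipartite

namespace Bipartite

noncomputable section

/-! ### The trace norm against the entrywise `l₁`-norm -/

/-! Let `σ` be the rotated state and `X` its partial transpose. Rotating `ρ` changes its partial
transpose only by a unitary conjugation, so `X` has the trace norm of the partial transpose of `ρ`,
namely `Re tr (s X)` for a unitary `s`. Entries of `s` have modulus at most one, so this is at most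
the sum of all `|X x y|`, which is `1 + C_{l₁}(σ)` because partial transposition permutes entries.
Pairing is the equality case: `|s x y| = 1` wherever `X y x ≠ 0`, and since rows of `s` have norm
one, each column of `X` has at most one nonzero entry (`column_subsingleton`).

An entangled `ρ` is not diagonal in any product basis, so `σ` has a coherence `c` between some `|a
b⟩` and `|a' b'⟩`. In `X` it lies in the columns of `|a b'⟩` and `|a' b⟩`, whose diagonal entries
must then vanish (`exists_coherence`). A 2×2 principal minor of `X` is therefore negative, which is
NPT.

For distillation, `σ` on the span of these four levels lives on `|a b⟩` and `|a' b'⟩` alone. A local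
filter balances the two populations; replacing failures by a classically correlated pair leaves a
dephased Bell pair with coherence `t > 0` (`exists_isLOCC_dephased`). Hadamards turn its phase
errors into bit flips, and `n` copies carry a random error vector over `ZMod 2`. A linear code found
by averaging over parity checks identifies that error at a positive rate (`exists_code`,
`exists_isLOCC_hashing`). -/

open scoped MatrixOrder Matrix.Norms.L2Operator in
/-- The trace norm of a Hermitian matrix is its trace against a self-adjoint unitary. -/
theorem exists_sign {S : Type} [Fintype S] [DecidableEq S] {M : Matrix S S ℂ}
    (hM : M.IsHermitian) :
    ∃ s : Matrix S S ℂ, s * sᴴ = 1 ∧ traceNorm M = (s * M).trace.re := by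
  have hsa : IsSelfAdjoint M := hM
  have hfin : (spectrum ℝ M).Finite := Matrix.finite_real_spectrum
  have hc : ∀ f : ℝ → ℝ, ContinuousOn f (spectrum ℝ M) := fun f => hfin.continuousOn f
  -- The value at `0` is `1` rather than `0`, so that `g * g = 1` and `cfc g M` is unitary even for
  -- singular `M`.
  set g : ℝ → ℝ := fun x => if 0 ≤ x then 1 else -1 with hg
  have hs : IsSelfAdjoint (cfc g M) := cfc_predicate g M
  refine ⟨cfc g M, ?_, ?_⟩
  · rw [← Matrix.star_eq_conjTranspose, hs.star_eq, ← cfc_mul g g M (hc _) (hc _)]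
    have : (fun x => g x * g x) = fun _ => 1 := by
      funext x
      simp only [hg]
      split_ifs <;> norm_num
    rw [this, cfc_const_one ℝ M]
  · have : cfc g M * M = CFC.abs M := by
      conv_lhs => rw [← cfc_id' ℝ M, cfc_id' ℝ M]
      nth_rewrite 2 [← cfc_id' ℝ M]
      rw [← cfc_mul g _ M (hc _) (hc _), CFC.abs_eq_cfc_norm M hsa]
      congr 1
      funext x
      simp only [hg, Real.norm_eq_abs]
      split_ifs with h
      · rw [abs_of_nonneg h, one_mul]
      · rw [abs_of_neg (not_le.mp h), neg_one_mul]
    rw [this, traceNorm]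

theorem sum_norm_sq_row {S : Type} [Fintype S] [DecidableEq S] {s : Matrix S S ℂ}
    (hs : s * sᴴ = 1) (x : S) : ∑ y, ‖s x y‖ ^ 2 = 1 := by
  have h := congrFun (congrFun hs x) x
  simp only [Matrix.mul_apply, Matrix.conjTranspose_apply, Matrix.one_apply_eq,
    RCLike.star_def, Complex.mul_conj'] at h
  exact_mod_cast h

/-- If the trace of `X` against a unitary is the sum of the moduli of its entries, then every
column of `X` has at most one nonzero entry. -/
theorem column_subsingleton {S : Type} [Fintype S] [DecidableEq S] {s X : Matrix S S ℂ}
    (hs : s * sᴴ = 1) (h : (s * X).trace.re = ∑ x, ∑ y, ‖X y x‖) {x y y' : S}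
    (hy : X y x ≠ 0) (hy' : X y' x ≠ 0) : y = y' := by
  have hle : ∀ x y, ‖s x y‖ ≤ 1 := fun x y => by
    have h1 : ‖s x y‖ ^ 2 ≤ 1 := by
      rw [← sum_norm_sq_row hs x]
      exact Finset.single_le_sum (f := fun y => ‖s x y‖ ^ 2) (fun _ _ => by positivity)
        (Finset.mem_univ y)
    exact (sq_le_one_iff₀ (norm_nonneg _)).mp h1
  have hterm : ∀ x y, (s x y * X y x).re ≤ ‖X y x‖ := fun x y =>
    (Complex.re_le_norm _).trans (by
      rw [norm_mul]; exact mul_le_of_le_one_left (norm_nonneg _) (hle x y))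
  have htr : (s * X).trace.re = ∑ x, ∑ y, (s x y * X y x).re := by
    simp [Matrix.trace, Matrix.mul_apply, Complex.re_sum]
  -- The slacks in `hterm` are nonnegative and sum to zero, so each one vanishes.
  have hone : ∀ x y, X y x ≠ 0 → ‖s x y‖ = 1 := fun x y hxy => by
    have h0 : ∑ x, ∑ y, (‖X y x‖ - (s x y * X y x).re) = 0 := by
      simp only [Finset.sum_sub_distrib]
      rw [← htr, h, sub_self]
    have h1 := (Finset.sum_eq_zero_iff_of_nonneg (fun x _ =>
      Finset.sum_nonneg fun y _ => sub_nonneg.mpr (hterm x y))).mp h0 x (Finset.mem_univ _)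
    have h2 := (Finset.sum_eq_zero_iff_of_nonneg (fun y _ =>
      sub_nonneg.mpr (hterm x y))).mp h1 y (Finset.mem_univ _)
    have h3 : ‖X y x‖ ≤ ‖s x y‖ * ‖X y x‖ := by
      rw [← norm_mul]; linarith [Complex.re_le_norm (s x y * X y x)]
    exact le_antisymm (hle x y) (le_of_mul_le_mul_right (by linarith) (norm_pos_iff.mpr hxy))
  by_contra hne
  have h1 := Finset.add_le_sum (f := fun y => ‖s x y‖ ^ 2) (s := Finset.univ)
    (fun _ _ => by positivity) (Finset.mem_univ y) (Finset.mem_univ y') hne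
  rw [sum_norm_sq_row hs x] at h1
  simp only [hone x y hy, hone x y' hy'] at h1
  norm_num at h1

/-- This is nonnegativity of the principal minor on `x`, `y`. A zero diagonal entry thus kills its
row and column. -/
theorem PosSemidef.norm_sq_le {S : Type} {M : Matrix S S ℂ} (hM : M.PosSemidef) (x y : S) :
    ‖M x y‖ ^ 2 ≤ (M x x).re * (M y y).re := by
  have h := (hM.submatrix ![x, y]).det_nonneg
  have hxy : M y x = star (M x y) := (hM.isHermitian.apply y x).symm
  have hx := hM.diag_nonneg (i := x)
  have hy := hM.diag_nonneg (i := y)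
  rw [Matrix.det_fin_two] at h
  simp only [Matrix.submatrix_apply, Matrix.cons_val_zero, Matrix.cons_val_one, hxy,
    RCLike.star_def, Complex.mul_conj'] at h
  have h1 := (Complex.le_def.mp h).1
  have hxi := (Complex.le_def.mp hx).2
  have e : ((‖M x y‖ : ℂ) ^ 2).re = ‖M x y‖ ^ 2 := by
    rw [← Complex.ofReal_pow, Complex.ofReal_re]
  simp only [Complex.sub_re, Complex.mul_re, e, Complex.zero_re] at h1
  simp only [Complex.zero_im] at hxi
  rw [← hxi] at h1
  linarith

/-! ### Partial transposes under local unitaries -/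

section LocalUnitary

variable {A B : Type} [Fintype A] [Fintype B] [DecidableEq A] [DecidableEq B]

theorem kronecker_mem_unitaryGroup {UA : Matrix A A ℂ} {UB : Matrix B B ℂ}
    (hA : UA ∈ Matrix.unitaryGroup A ℂ) (hB : UB ∈ Matrix.unitaryGroup B ℂ) :
    (UA ⊗ₖ UB)ᴴ * (UA ⊗ₖ UB) = 1 := by
  rw [Matrix.conjTranspose_kronecker, ← Matrix.mul_kronecker_mul, ← Matrix.star_eq_conjTranspose,
    ← Matrix.star_eq_conjTranspose, Matrix.mem_unitaryGroup_iff'.mp hA,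
    Matrix.mem_unitaryGroup_iff'.mp hB, Matrix.one_kronecker_one]

theorem map_star_mem_unitaryGroup {UA : Matrix A A ℂ} (hA : UA ∈ Matrix.unitaryGroup A ℂ) :
    UA.map star ∈ Matrix.unitaryGroup A ℂ := by
  rw [Matrix.mem_unitaryGroup_iff'] at hA ⊢
  have : (star UA * UA).map (starRingEnd ℂ) = 1 := by rw [hA]; simp
  rw [Matrix.map_mul] at this
  exact this

/-- Transposing on `A` exchanges the roles of `UA` and its adjoint, so Alice acts by the entrywise
conjugate of `UA`, again a unitary when `UA` is one. In coordinates this is the exchange `hswap` of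
the two summed `A`-indices. -/
theorem partialTransposeA_conj {A B : Type} [Fintype A] [Fintype B] (UA : Matrix A A ℂ)
    (UB : Matrix B B ℂ) (ρ : Matrix (A × B) (A × B) ℂ) :
    partialTransposeA ((UA ⊗ₖ UB) * ρ * (UA ⊗ₖ UB)ᴴ) =
      (UA.map star ⊗ₖ UB) * partialTransposeA ρ * (UA.map star ⊗ₖ UB)ᴴ := by
  ext ⟨a, b⟩ ⟨a', b'⟩
  simp only [partialTransposeA, Matrix.of_apply, Matrix.mul_apply, Matrix.conjTranspose_apply,
    Matrix.kroneckerMap_apply, Fintype.sum_prod_type, Matrix.map_apply, Finset.sum_mul,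
    star_mul', star_star]
  have hswap : ∀ f : A → B → A → B → ℂ,
      ∑ u, ∑ v, ∑ u', ∑ v', f u v u' v' = ∑ u, ∑ v, ∑ u', ∑ v', f u' v u v' := fun f => by
    have h1 : ∀ g : A → B → A → B → ℂ, ∑ u, ∑ v, ∑ u', ∑ v', g u v u' v' =
        ∑ u, ∑ u', ∑ v, ∑ v', g u v u' v' := fun g =>
      Finset.sum_congr rfl fun u _ => Finset.sum_comm
    rw [h1, h1, Finset.sum_comm]
  rw [hswap]
  refine Finset.sum_congr rfl fun u _ => Finset.sum_congr rfl fun v _ =>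
    Finset.sum_congr rfl fun u' _ => Finset.sum_congr rfl fun v' _ => ?_
  ring

theorem isHermitian_partialTransposeA {A B : Type} {ρ : Matrix (A × B) (A × B) ℂ}
    (hρ : ρ.IsHermitian) : (partialTransposeA ρ).IsHermitian := by
  ext x y
  exact hρ.apply _ _

theorem isState_conj {S : Type} [Fintype S] [DecidableEq S] {ρ U : Matrix S S ℂ}
    (hρ : IsState ρ) (hU : Uᴴ * U = 1) : IsState (U * ρ * Uᴴ) where
  posSemidef := hρ.posSemidef.mul_mul_conjTranspose_same U
  trace_eq_one := by
    rw [Matrix.trace_mul_comm, ← Matrix.mul_assoc, hU, Matrix.one_mul, hρ.trace_eq_one]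

theorem isState_single {S : Type} [Fintype S] [DecidableEq S] (a : S) :
    IsState (Matrix.single a a (1 : ℂ)) where
  posSemidef := by
    rw [← Matrix.diagonal_single]
    refine Matrix.PosSemidef.diagonal fun i => ?_
    by_cases h : i = a
    · subst h; simp
    · simp [h]
  trace_eq_one := by simp

/-- A state that is diagonal in some product basis is separable. -/
theorem isSeparable_of_conj_diagonal {UA : Matrix A A ℂ} {UB : Matrix B B ℂ}
    (hA : UA ∈ Matrix.unitaryGroup A ℂ) (hB : UB ∈ Matrix.unitaryGroup B ℂ)
    {ρ : Matrix (A × B) (A × B) ℂ} (hρ : IsState ρ)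
    (hd : ∀ x y, x ≠ y → ((UA ⊗ₖ UB) * ρ * (UA ⊗ₖ UB)ᴴ) x y = 0) : IsSeparable ρ := by
  set U := UA ⊗ₖ UB with hUdef
  have hU : Uᴴ * U = 1 := kronecker_mem_unitaryGroup hA hB
  set σ := U * ρ * Uᴴ with hσdef
  have hσ : IsState σ := isState_conj hρ hU
  have hρσ : ρ = Uᴴ * σ * U := by
    rw [hσdef, ← Matrix.mul_assoc, ← Matrix.mul_assoc, hU, Matrix.one_mul, Matrix.mul_assoc, hU,
      Matrix.mul_one]
  have hnn : ∀ x, 0 ≤ σ x x := fun x => hσ.posSemidef.diag_nonneg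
  have hσsum : σ = ∑ x, (σ x x).re • Matrix.single x x (1 : ℂ) := by
    ext x y
    rw [Matrix.sum_apply]
    simp only [Matrix.smul_apply, Matrix.single_apply, Complex.real_smul]
    by_cases h : x = y
    · subst h
      rw [Finset.sum_eq_single x]
      · simpa using (Complex.eq_re_of_ofReal_le (r := 0) (by simpa using hnn x))
      · intro b _ hb; simp [hb]
      · simp
    · rw [hd x y h, Finset.sum_eq_zero]
      intro z _
      have : ¬ (z = x ∧ z = y) := fun hh => h (hh.1.symm.trans hh.2)
      simp [this]
  have hA' : (UAᴴ)ᴴ * UAᴴ = 1 := by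
    rw [Matrix.conjTranspose_conjTranspose]; exact Matrix.mem_unitaryGroup_iff.mp hA
  have hB' : (UBᴴ)ᴴ * UBᴴ = 1 := by
    rw [Matrix.conjTranspose_conjTranspose]; exact Matrix.mem_unitaryGroup_iff.mp hB
  have hrep : ρ = ∑ x : A × B, (σ x x).re •
      ((UAᴴ * Matrix.single x.1 x.1 1 * UAᴴᴴ) ⊗ₖ (UBᴴ * Matrix.single x.2 x.2 1 * UBᴴᴴ)) := by
    rw [hρσ]
    conv_lhs => rw [hσsum]
    rw [Matrix.mul_sum, Matrix.sum_mul]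
    refine Finset.sum_congr rfl fun x _ => ?_
    rw [Matrix.mul_smul, Matrix.smul_mul, Matrix.mul_kronecker_mul, Matrix.mul_kronecker_mul,
      Matrix.single_kronecker_single, hUdef, Matrix.conjTranspose_kronecker,
      Matrix.conjTranspose_conjTranspose, Matrix.conjTranspose_conjTranspose, one_mul]
  rw [hrep]
  refine (convex_convexHull ℝ _).sum_mem (fun x _ => (Complex.le_def.mp (hnn x)).1) ?_
    fun x _ => subset_convexHull ℝ _
      ⟨_, _, isState_conj (isState_single x.1) hA', isState_conj (isState_single x.2) hB', rfl⟩
  have := congrArg Complex.re hσ.trace_eq_one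
  simpa [Matrix.trace, Complex.re_sum] using this

/-- In a suitable product basis, an entangled pairing state has a nonzero coherence whose partner
levels are unpopulated. -/
theorem exists_coherence {ρ : Matrix (A × B) (A × B) ℂ} (hpair : IsPairing ρ)
    (hent : IsEntangled ρ) :
    ∃ UA ∈ Matrix.unitaryGroup A ℂ, ∃ UB ∈ Matrix.unitaryGroup B ℂ, ∃ (a a' : A) (b b' : B),
      ((UA ⊗ₖ UB) * ρ * (UA ⊗ₖ UB)ᴴ) (a, b) (a', b') ≠ 0 ∧
      ((UA ⊗ₖ UB) * ρ * (UA ⊗ₖ UB)ᴴ) (a, b') (a, b') = 0 ∧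
      ((UA ⊗ₖ UB) * ρ * (UA ⊗ₖ UB)ᴴ) (a', b) (a', b) = 0 := by
  obtain ⟨hρ, UA, hA, UB, hB, hN⟩ := hpair
  refine ⟨UA, hA, UB, hB, ?_⟩
  set σ := (UA ⊗ₖ UB) * ρ * (UA ⊗ₖ UB)ᴴ with hσdef
  have hσ : IsState σ := isState_conj hρ (kronecker_mem_unitaryGroup hA hB)
  set W := UA.map star ⊗ₖ UB with hW
  have hWu : Wᴴ * W = 1 := kronecker_mem_unitaryGroup (map_star_mem_unitaryGroup hA) hB
  have hWu' : W * Wᴴ = 1 := mul_eq_one_comm.mp hWu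
  have hX : partialTransposeA σ = W * partialTransposeA ρ * Wᴴ := partialTransposeA_conj UA UB ρ
  obtain ⟨s, hs, htr⟩ :=
    exists_sign (isHermitian_partialTransposeA hρ.posSemidef.isHermitian)
  have hs' : (W * s * Wᴴ) * (W * s * Wᴴ)ᴴ = 1 := by
    simp only [Matrix.conjTranspose_mul, Matrix.conjTranspose_conjTranspose, Matrix.mul_assoc]
    rw [← Matrix.mul_assoc Wᴴ W, hWu, Matrix.one_mul, ← Matrix.mul_assoc s, hs, Matrix.one_mul,
      hWu']
  have htr' : ((W * s * Wᴴ) * partialTransposeA σ).trace = (s * partialTransposeA ρ).trace := by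
    rw [hX]
    have : W * s * Wᴴ * (W * partialTransposeA ρ * Wᴴ) = W * (s * partialTransposeA ρ) * Wᴴ := by
      simp only [Matrix.mul_assoc]
      rw [← Matrix.mul_assoc Wᴴ W, hWu, Matrix.one_mul]
    rw [this, Matrix.trace_mul_comm, ← Matrix.mul_assoc, hWu, Matrix.one_mul]
  have hsum : ∑ x, ∑ y, ‖partialTransposeA σ y x‖ = 1 + l1Coherence σ := by
    have h1 : ∑ x, ∑ y, ‖partialTransposeA σ y x‖ = ∑ x, ∑ y, ‖σ x y‖ := by
      simp only [partialTransposeA, Matrix.of_apply, Fintype.sum_prod_type]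
      refine Finset.sum_congr rfl fun a _ => ?_
      rw [Finset.sum_comm]
      conv_rhs => rw [Finset.sum_comm]
      exact Finset.sum_congr rfl fun a' _ => Finset.sum_comm
    have h2 : ∑ x, ‖σ x x‖ = 1 := by
      have h3 := congrArg Complex.re hσ.trace_eq_one
      rw [Matrix.trace, Complex.re_sum, Complex.one_re] at h3
      rw [← h3]
      refine Finset.sum_congr rfl fun x _ => ?_
      rw [Matrix.diag_apply]
      simpa using congrArg Complex.re
        (Complex.norm_of_nonneg' (hσ.posSemidef.diag_nonneg (i := x)))
    rw [h1, ← h2, l1Coherence, ← Finset.sum_add_distrib]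
    refine Finset.sum_congr rfl fun x _ => ?_
    rw [← Finset.add_sum_erase _ _ (Finset.mem_univ x), ← Finset.sum_filter]
    congr 1
    refine Finset.sum_congr ?_ fun _ _ => rfl
    ext y
    simp [eq_comm]
  -- The conjugated sign `W * s * Wᴴ` attains the entrywise bound exactly because of the pairing
  -- equation `hN`.
  have hcol : ∀ x y y', partialTransposeA σ y x ≠ 0 → partialTransposeA σ y' x ≠ 0 → y = y' := by
    intro x y y'
    refine column_subsingleton hs' ?_
    rw [htr', ← htr, hsum, ← hN, negativity]
    ring
  by_contra hno
  push Not at hno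
  refine hent.2 (isSeparable_of_conj_diagonal hA hB hρ fun x y hxy => ?_)
  by_contra h0
  obtain ⟨a, b⟩ := x
  obtain ⟨a', b'⟩ := y
  have hherm := isHermitian_partialTransposeA (ρ := σ) hσ.posSemidef.isHermitian
  -- The coherence sits off the diagonal of the partial transpose, so a nonzero diagonal entry in
  -- its column would be a second one there.
  have hne : (a', b) ≠ (a, b') := fun h => hxy (by simp_all)
  have h1 : partialTransposeA σ (a', b) (a, b') ≠ 0 := h0
  have h2 : partialTransposeA σ (a, b') (a', b) ≠ 0 := by
    rw [← hherm.apply]; simpa using h1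
  refine hno a a' b b' h0 ?_ ?_
  · by_contra h3
    exact hne (hcol (a, b') _ (a, b') h1 h3)
  · by_contra h3
    exact hne (hcol (a', b) (a', b) _ h3 h2)

end LocalUnitary

/-! ### Closure properties of LOCC transformations -/

theorem IsLOCC.map_sum {A B C D : Type}
    {Λ : Matrix (A × B) (A × B) ℂ → Matrix (C × D) (C × D) ℂ} (h : IsLOCC Λ)
    {κ : Type} (s : Finset κ) (X : κ → Matrix (A × B) (A × B) ℂ) :
    Λ (∑ j ∈ s, X j) = ∑ j ∈ s, Λ (X j) := by
  induction h with
  | finish => rfl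
  | alice K hK Λ hΛ ih =>
    simp only [Matrix.mul_sum, Matrix.sum_mul, ih]
    exact Finset.sum_comm
  | bob K hK Λ hΛ ih =>
    simp only [Matrix.mul_sum, Matrix.sum_mul, ih]
    exact Finset.sum_comm

theorem IsLOCC.map_smul {A B C D : Type}
    {Λ : Matrix (A × B) (A × B) ℂ → Matrix (C × D) (C × D) ℂ} (h : IsLOCC Λ)
    (c : ℂ) (X : Matrix (A × B) (A × B) ℂ) : Λ (c • X) = c • Λ X := by
  induction h with
  | finish => rfl
  | alice K hK Λ hΛ ih => simp only [Matrix.mul_smul, Matrix.smul_mul, ih, Finset.smul_sum]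
  | bob K hK Λ hΛ ih => simp only [Matrix.mul_smul, Matrix.smul_mul, ih, Finset.smul_sum]

/-- The second protocol is grafted onto every leaf of the first; its additivity moves it inside the
sums over outcomes. -/
theorem IsLOCC.comp {A B C D E F : Type}
    {Λ' : Matrix (C × D) (C × D) ℂ → Matrix (E × F) (E × F) ℂ} (h' : IsLOCC Λ')
    {Λ : Matrix (A × B) (A × B) ℂ → Matrix (C × D) (C × D) ℂ} (h : IsLOCC Λ) :
    IsLOCC fun X => Λ' (Λ X) := by
  induction h with
  | finish => exact h'
  | alice K hK Λ hΛ ih =>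
    simp only [h'.map_sum]
    exact IsLOCC.alice K hK (fun i X => Λ' (Λ i X)) ih
  | bob K hK Λ hΛ ih =>
    simp only [h'.map_sum]
    exact IsLOCC.bob K hK (fun i X => Λ' (Λ i X)) ih

theorem sum_single_one {S : Type} [Fintype S] [DecidableEq S] :
    ∑ a : S, Matrix.single a a (1 : ℂ) = 1 := by
  ext i j
  rw [Matrix.sum_apply]
  simp only [Matrix.single_apply, Matrix.one_apply]
  by_cases h : i = j
  · subst h; simp
  · rw [if_neg h]
    exact Finset.sum_eq_zero fun k _ => if_neg fun hh => h (hh.1.symm.trans hh.2)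

/-! ### Local isometries, relabellings and spectator systems -/

section Local

variable {A B : Type} [Fintype A] [Fintype B] [DecidableEq A] [DecidableEq B]

theorem isLOCC_conj_alice {E : Type} [Fintype E] (K : Matrix E A ℂ) (hK : Kᴴ * K = 1) :
    IsLOCC fun X : Matrix (A × B) (A × B) ℂ =>
      (K ⊗ₖ (1 : Matrix B B ℂ)) * X * (K ⊗ₖ (1 : Matrix B B ℂ))ᴴ := by
  have := IsLOCC.alice (B := B) (ι := Unit) (fun _ => K) (by simpa using hK) (fun _ X => X)
    fun _ => IsLOCC.finish
  simpa using this

theorem isLOCC_conj_bob {E : Type} [Fintype E] (K : Matrix E B ℂ) (hK : Kᴴ * K = 1) :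
    IsLOCC fun X : Matrix (A × B) (A × B) ℂ =>
      ((1 : Matrix A A ℂ) ⊗ₖ K) * X * ((1 : Matrix A A ℂ) ⊗ₖ K)ᴴ := by
  have := IsLOCC.bob (A := A) (ι := Unit) (fun _ => K) (by simpa using hK) (fun _ X => X)
    fun _ => IsLOCC.finish
  simpa using this

theorem conj_bob_conj_alice {A B E F : Type} [Fintype A] [Fintype B] [DecidableEq B] [Fintype E]
    [DecidableEq E] (K : Matrix E A ℂ) (L : Matrix F B ℂ) (X : Matrix (A × B) (A × B) ℂ) :
    ((1 : Matrix E E ℂ) ⊗ₖ L) * ((K ⊗ₖ (1 : Matrix B B ℂ)) * X * (K ⊗ₖ (1 : Matrix B B ℂ))ᴴ) *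
      ((1 : Matrix E E ℂ) ⊗ₖ L)ᴴ = (K ⊗ₖ L) * X * (K ⊗ₖ L)ᴴ := by
  have h : K ⊗ₖ L = ((1 : Matrix E E ℂ) ⊗ₖ L) * (K ⊗ₖ (1 : Matrix B B ℂ)) := by
    rw [← Matrix.mul_kronecker_mul, Matrix.one_mul, Matrix.mul_one]
  rw [h, Matrix.conjTranspose_mul]
  simp only [Matrix.mul_assoc]

theorem conj_alice_apply {A B E : Type} [Fintype A] [Fintype B] [DecidableEq B]
    (K : Matrix E A ℂ) (X : Matrix (A × B) (A × B) ℂ) (x y : E × B) :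
    ((K ⊗ₖ (1 : Matrix B B ℂ)) * X * (K ⊗ₖ (1 : Matrix B B ℂ))ᴴ) x y =
      ∑ a', (∑ a, K x.1 a * X (a, x.2) (a', y.2)) * star (K y.1 a') := by
  simp [Matrix.mul_apply, Fintype.sum_prod_type, Matrix.one_apply, apply_ite]

theorem conj_bob_apply {A B E : Type} [Fintype A] [Fintype B] [DecidableEq A]
    (K : Matrix E B ℂ) (X : Matrix (A × B) (A × B) ℂ) (x y : A × E) :
    (((1 : Matrix A A ℂ) ⊗ₖ K) * X * ((1 : Matrix A A ℂ) ⊗ₖ K)ᴴ) x y =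
      ∑ b', (∑ b, K x.2 b * X (x.1, b) (y.1, b')) * star (K y.2 b') := by
  simp [Matrix.mul_apply, Fintype.sum_prod_type_right, Matrix.one_apply, apply_ite]

/-- Local isometries are LOCC. -/
theorem isLOCC_conj {E F : Type} [Fintype E] [Fintype F] (K : Matrix E A ℂ) (hK : Kᴴ * K = 1)
    (L : Matrix F B ℂ) (hL : Lᴴ * L = 1) :
    IsLOCC fun X : Matrix (A × B) (A × B) ℂ => (K ⊗ₖ L) * X * (K ⊗ₖ L)ᴴ := by
  classical
  have := (isLOCC_conj_bob (A := E) L hL).comp (isLOCC_conj_alice (B := B) K hK)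
  simpa only [conj_bob_conj_alice] using this

/-- The matrix sending the basis vector `f e` to `e`. -/
def selection {A : Type} [DecidableEq A] {E : Type} (f : E → A) : Matrix E A ℂ :=
  (1 : Matrix A A ℂ).submatrix f id

theorem conjTranspose_selection_mul {A : Type} [DecidableEq A] {E : Type} [Fintype E] (f : E → A) :
    (selection f)ᴴ * selection f = ∑ e, Matrix.single (f e) (f e) 1 := by
  ext a a'
  rw [Matrix.sum_apply]
  simp only [selection, Matrix.mul_apply, Matrix.conjTranspose_apply, Matrix.submatrix_apply,
    id, Matrix.one_apply, Matrix.single_apply]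
  refine Finset.sum_congr rfl fun e _ => ?_
  by_cases h1 : f e = a <;> by_cases h2 : f e = a' <;> simp [h1, h2]

theorem conj_selection {E F : Type} (f : E → A) (g : F → B)
    (X : Matrix (A × B) (A × B) ℂ) :
    (selection f ⊗ₖ selection g) * X * (selection f ⊗ₖ selection g)ᴴ =
      X.submatrix (Prod.map f g) (Prod.map f g) := by
  have h : selection f ⊗ₖ selection g =
      (1 : Matrix (A × B) (A × B) ℂ).submatrix (Prod.map f g) id := by
    rw [selection, selection, ← Matrix.one_kronecker_one]; rfl
  rw [h]
  ext x y
  simp [Matrix.mul_apply, Matrix.one_apply]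

theorem isLOCC_reindex {E F : Type} [Fintype E] [Fintype F] (f : E ≃ A) (g : F ≃ B) :
    IsLOCC fun X : Matrix (A × B) (A × B) ℂ => X.submatrix (Prod.map f g) (Prod.map f g) := by
  have key : ∀ {G H : Type} [Fintype G] [Fintype H] [DecidableEq H] (f : G ≃ H),
      (selection f)ᴴ * selection f = 1 := fun f => by
    rw [conjTranspose_selection_mul, f.sum_comp (fun a => Matrix.single a a (1 : ℂ)),
      sum_single_one]
  have := isLOCC_conj (selection f) (key f) (selection g) (key g)
  simpa only [conj_selection] using this

end Local

/-- `Λ ⊗ id`, with spectator systems `A'` and `B'`. -/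
def amplify {A B C D : Type} (A' B' : Type)
    (Λ : Matrix (A × B) (A × B) ℂ → Matrix (C × D) (C × D) ℂ)
    (X : Matrix ((A × A') × (B × B')) ((A × A') × (B × B')) ℂ) :
    Matrix ((C × A') × (D × B')) ((C × A') × (D × B')) ℂ :=
  Matrix.of fun x y => Λ (Matrix.of fun u v =>
    X ((u.1, x.1.2), (u.2, x.2.2)) ((v.1, y.1.2), (v.2, y.2.2))) (x.1.1, x.2.1) (y.1.1, y.2.1)

/-- Every Kraus operator is tensored with the identity of the spectator, which preserves
completeness and acts separately on each spectator block. -/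
theorem IsLOCC.amplify {A B C D A' B' : Type} [Fintype A'] [Fintype B'] [DecidableEq A']
    [DecidableEq B'] {Λ : Matrix (A × B) (A × B) ℂ → Matrix (C × D) (C × D) ℂ} (h : IsLOCC Λ) :
    IsLOCC (amplify A' B' Λ) := by
  induction h with
  | finish => exact IsLOCC.finish
  | @alice A B ι E _ _ _ _ _ _ K hK Λ hΛ ih =>
    have h := IsLOCC.alice (A := A × A') (B := B × B') (fun i => K i ⊗ₖ (1 : Matrix A' A' ℂ))
      (by
        simp only [Matrix.conjTranspose_kronecker, ← Matrix.mul_kronecker_mul,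
          Matrix.conjTranspose_one, Matrix.mul_one]
        rw [← Matrix.one_kronecker_one, ← hK]
        ext x y
        simp only [Matrix.sum_apply, Matrix.kroneckerMap_apply, Finset.sum_mul])
      _ ih
    convert h using 1
    funext X
    ext x y
    rw [Matrix.sum_apply]
    simp only [Bipartite.amplify, Matrix.of_apply]
    rw [Matrix.sum_apply]
    refine Finset.sum_congr rfl fun i _ => ?_
    congr 2
    ext u v
    rw [Matrix.of_apply, conj_alice_apply, conj_alice_apply]
    simp only [Matrix.of_apply, Matrix.kroneckerMap_apply, Fintype.sum_prod_type,
      Matrix.one_apply, mul_ite, mul_one, mul_zero, ite_mul, zero_mul,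
      apply_ite (star : ℂ → ℂ), star_zero, Finset.sum_ite_eq, Finset.mem_univ, if_true]
  | @bob A B ι E _ _ _ _ _ _ K hK Λ hΛ ih =>
    have h := IsLOCC.bob (A := A × A') (B := B × B') (fun i => K i ⊗ₖ (1 : Matrix B' B' ℂ))
      (by
        simp only [Matrix.conjTranspose_kronecker, ← Matrix.mul_kronecker_mul,
          Matrix.conjTranspose_one, Matrix.mul_one]
        rw [← Matrix.one_kronecker_one, ← hK]
        ext x y
        simp only [Matrix.sum_apply, Matrix.kroneckerMap_apply, Finset.sum_mul])
      _ ih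
    convert h using 1
    funext X
    ext x y
    rw [Matrix.sum_apply]
    simp only [Bipartite.amplify, Matrix.of_apply]
    rw [Matrix.sum_apply]
    refine Finset.sum_congr rfl fun i _ => ?_
    congr 2
    ext u v
    rw [Matrix.of_apply, conj_bob_apply, conj_bob_apply]
    simp only [Matrix.of_apply, Matrix.kroneckerMap_apply, Fintype.sum_prod_type,
      Matrix.one_apply, mul_ite, mul_one, mul_zero, ite_mul, zero_mul,
      apply_ite (star : ℂ → ℂ), star_zero, Finset.sum_ite_eq, Finset.mem_univ, if_true]

/-- The product of two bipartite states, as a bipartite state between the two `A`-systems and the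
two `B`-systems. -/
def tensor {A B A' B' : Type} (X : Matrix (A × B) (A × B) ℂ)
    (Y : Matrix (A' × B') (A' × B') ℂ) :
    Matrix ((A × A') × (B × B')) ((A × A') × (B × B')) ℂ :=
  Matrix.of fun x y => X (x.1.1, x.2.1) (y.1.1, y.2.1) * Y (x.1.2, x.2.2) (y.1.2, y.2.2)

/-- For fixed spectator indices the block of the product is a scalar multiple of `X`, so homogeneity
of `Λ` suffices. -/
theorem IsLOCC.amplify_tensor {A B C D A' B' : Type}
    {Λ : Matrix (A × B) (A × B) ℂ → Matrix (C × D) (C × D) ℂ} (h : IsLOCC Λ)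
    (X : Matrix (A × B) (A × B) ℂ) (Y : Matrix (A' × B') (A' × B') ℂ) :
    Bipartite.amplify A' B' Λ (tensor X Y) = tensor (Λ X) Y := by
  ext x y
  have : (Matrix.of fun u v => tensor X Y ((u.1, x.1.2), (u.2, x.2.2)) ((v.1, y.1.2), (v.2, y.2.2)))
      = Y (x.1.2, x.2.2) (y.1.2, y.2.2) • X := by
    ext u v
    simp [tensor, mul_comm]
  rw [Bipartite.amplify, Matrix.of_apply, this, h.map_smul]
  simp [tensor, mul_comm]

/-- An LOCC transformation can be applied to each of `n` copies. -/
theorem IsLOCC.copies {A B C D : Type} [Fintype A] [Fintype B] [Fintype C] [Fintype D]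
    {Λ : Matrix (A × B) (A × B) ℂ → Matrix (C × D) (C × D) ℂ} (h : IsLOCC Λ)
    (ρ : Matrix (A × B) (A × B) ℂ) (n : ℕ) :
    ∃ Λ' : Matrix ((Fin n → A) × (Fin n → B)) ((Fin n → A) × (Fin n → B)) ℂ →
        Matrix ((Fin n → C) × (Fin n → D)) ((Fin n → C) × (Fin n → D)) ℂ,
      IsLOCC Λ' ∧ Λ' (copies ρ n) = Bipartite.copies (Λ ρ) n := by
  classical
  induction n with
  | zero =>
    refine ⟨_, isLOCC_reindex (Equiv.ofUnique (Fin 0 → C) (Fin 0 → A))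
      (Equiv.ofUnique (Fin 0 → D) (Fin 0 → B)), ?_⟩
    ext x y
    simp [Bipartite.copies]
  | succ n ih =>
    obtain ⟨Λ', hΛ', he⟩ := ih
    -- Split off the first copy, process it with the others as spectators, swap, process the others
    -- with the first as spectator, and reassemble.
    have h1 := isLOCC_reindex (Fin.consEquiv fun _ : Fin (n + 1) => A)
      (Fin.consEquiv fun _ : Fin (n + 1) => B)
    have h2 : IsLOCC (Bipartite.amplify (Fin n → A) (Fin n → B) Λ) := h.amplify
    have h3 := isLOCC_reindex (Equiv.prodComm (Fin n → A) C) (Equiv.prodComm (Fin n → B) D)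
    have h4 : IsLOCC (Bipartite.amplify C D Λ') := hΛ'.amplify
    have h5 := isLOCC_reindex
      ((Fin.consEquiv fun _ : Fin (n + 1) => C).symm.trans (Equiv.prodComm C (Fin n → C)))
      ((Fin.consEquiv fun _ : Fin (n + 1) => D).symm.trans (Equiv.prodComm D (Fin n → D)))
    refine ⟨_, h5.comp (h4.comp (h3.comp (h2.comp h1))), ?_⟩
    have e1 : (Bipartite.copies ρ (n + 1)).submatrix
        (Prod.map (Fin.consEquiv fun _ : Fin (n + 1) => A) (Fin.consEquiv fun _ : Fin (n + 1) => B))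
        (Prod.map (Fin.consEquiv fun _ : Fin (n + 1) => A) (Fin.consEquiv fun _ : Fin (n + 1) => B))
        = tensor ρ (Bipartite.copies ρ n) := by
      ext x y
      simp [Bipartite.copies, tensor, Fin.prod_univ_succ, Fin.consEquiv]
    have e3 : (tensor (Λ ρ) (Bipartite.copies ρ n)).submatrix
        (Prod.map (Equiv.prodComm (Fin n → A) C) (Equiv.prodComm (Fin n → B) D))
        (Prod.map (Equiv.prodComm (Fin n → A) C) (Equiv.prodComm (Fin n → B) D))
        = tensor (Bipartite.copies ρ n) (Λ ρ) := by
      ext x y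
      simp [tensor, mul_comm]
    rw [e1, h.amplify_tensor, e3, hΛ'.amplify_tensor, he]
    ext x y
    simp [Bipartite.copies, tensor, Fin.prod_univ_succ, Fin.consEquiv, mul_comm, Fin.tail]

/-! ### Local filtering with a classically correlated replacement on failure -/

/-- The classically correlated two-qubit state `(|00⟩⟨00| + |11⟩⟨11|) / 2` with its coherences
multiplied by `t`: maximally entangled for `t = 1` and separable for `t = 0`. -/
def dephased (t : ℝ) : Matrix (Fin 2 × Fin 2) (Fin 2 × Fin 2) ℂ :=
  Matrix.of fun x y => if x.1 = x.2 ∧ y.1 = y.2 then (if x = y then 1 / 2 else (t : ℂ) / 2) else 0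

theorem inv_sqrt_two_mul_self : ((√2 : ℝ) : ℂ)⁻¹ * ((√2 : ℝ) : ℂ)⁻¹ = 1 / 2 := by
  rw [← mul_inv, ← Complex.ofReal_mul, Real.mul_self_sqrt (by norm_num)]; norm_num

section Filter

variable {A B : Type} [Fintype A] [Fintype B] [DecidableEq A] [DecidableEq B]

theorem sum_single_mul_star {S E : Type} [Fintype S] [DecidableEq S] [DecidableEq E] (r x y : E)
    (k : S) (z : ℂ) (g : S → S → ℂ) :
    ∑ a', (∑ a, Matrix.single r k z x a * g a a') * star (Matrix.single r k z y a') =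
      if r = x ∧ r = y then z * g k k * star z else 0 := by
  have h : ∀ a' : S, (∑ a, Matrix.single r k z x a * g a a') * star (Matrix.single r k z y a') =
      if k = a' then (if r = x ∧ r = y then z * g k k * star z else 0) else 0 := fun a' => by
    rw [Finset.sum_eq_single k (fun a _ ha => by simp [ha.symm]) (by simp)]
    by_cases hk : k = a'
    · subst hk
      by_cases hx : r = x
      · subst hx
        by_cases hy : r = y <;> simp [hy]
      · simp [Matrix.single_apply, hx]
    · simp [Matrix.single_apply, hk]
  simp only [h, Finset.sum_ite_eq, Finset.mem_univ, if_true]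

/-- Discarding the input and preparing a classically correlated pair of bits is LOCC. -/
theorem isLOCC_prepare :
    IsLOCC fun X : Matrix (A × B) (A × B) ℂ => X.trace • dephased 0 := by
  have hs := inv_sqrt_two_mul_self
  -- Outcome `i` combines a fair coin `i.1`, responsible for the factor `1 / √2`, with the basis
  -- measurement result `i.2`. Both parties then prepare the announced coin.
  have h := IsLOCC.alice (A := A) (B := B) (ι := Fin 2 × A) (E := fun _ => Fin 2)
    (fun i => Matrix.single i.1 i.2 ((√2 : ℝ) : ℂ)⁻¹)
    (by
      ext a a'
      simp only [Matrix.sum_apply, Fintype.sum_prod_type, Matrix.conjTranspose_single,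
        Matrix.single_mul_single_same, Matrix.single_apply, Matrix.one_apply, star_inv₀,
        RCLike.star_def, Complex.conj_ofReal, hs]
      by_cases h : a = a'
      · subst h; norm_num
      · rw [if_neg h]
        exact Finset.sum_eq_zero fun _ _ => Finset.sum_eq_zero fun k _ =>
          if_neg fun hh => h (hh.1.symm.trans hh.2))
    (fun i X => ∑ b, ((1 : Matrix (Fin 2) (Fin 2) ℂ) ⊗ₖ Matrix.single i.1 b 1) * X *
      ((1 : Matrix (Fin 2) (Fin 2) ℂ) ⊗ₖ Matrix.single i.1 b 1)ᴴ)
    (fun i => IsLOCC.bob (ι := B) (E := fun _ => Fin 2) (fun b => Matrix.single i.1 b 1)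
      (by
        simp only [Matrix.conjTranspose_single, Matrix.single_mul_single_same, star_one, one_mul,
          sum_single_one])
      (fun _ X => X) fun _ => IsLOCC.finish)
  convert h using 1
  funext X
  ext x y
  have hs' : ∀ z : ℂ, ((√2 : ℝ) : ℂ)⁻¹ * z * star ((√2 : ℝ) : ℂ)⁻¹ = z / 2 := fun z => by
    rw [star_inv₀, RCLike.star_def, Complex.conj_ofReal, mul_right_comm, hs]; ring
  simp only [Matrix.sum_apply, conj_bob_apply, conj_alice_apply, sum_single_mul_star,
    Matrix.smul_apply, dephased, Matrix.of_apply, Fintype.sum_prod_type, Matrix.trace, smul_eq_mul,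
    Fin.sum_univ_two, Matrix.diag_apply, hs', star_one, mul_one, one_mul]
  obtain ⟨x, x'⟩ := x
  obtain ⟨y, y'⟩ := y
  fin_cases x <;> fin_cases x' <;> fin_cases y <;> fin_cases y' <;>
    simp [div_eq_mul_inv, Finset.sum_mul]

/-- A two-outcome measurement by Alice. -/
theorem isLOCC_alice_two {C D E E' : Type} [Fintype E] [Fintype E'] (F : Matrix E A ℂ)
    (L : Matrix E' A ℂ) (h : Fᴴ * F + Lᴴ * L = 1)
    {Λ : Matrix (E × B) (E × B) ℂ → Matrix (C × D) (C × D) ℂ}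
    {Λ' : Matrix (E' × B) (E' × B) ℂ → Matrix (C × D) (C × D) ℂ}
    (hΛ : IsLOCC Λ) (hΛ' : IsLOCC Λ') :
    IsLOCC fun X : Matrix (A × B) (A × B) ℂ =>
      Λ ((F ⊗ₖ (1 : Matrix B B ℂ)) * X * (F ⊗ₖ (1 : Matrix B B ℂ))ᴴ) +
      Λ' ((L ⊗ₖ (1 : Matrix B B ℂ)) * X * (L ⊗ₖ (1 : Matrix B B ℂ))ᴴ) := by
  let _ : ∀ i : Bool, Fintype (cond i E E') := fun i => by cases i <;> assumption
  have := IsLOCC.alice (A := A) (B := B) (ι := Bool) (E := fun i => cond i E E')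
    (fun i => match i with | true => F | false => L)
    (by rw [Fintype.sum_bool]; exact h)
    (fun i => match i with | true => Λ | false => Λ')
    (fun i => match i with | true => hΛ | false => hΛ')
  simp only [Fintype.sum_bool] at this
  exact this

/-- A two-outcome measurement by Bob. -/
theorem isLOCC_bob_two {C D E E' : Type} [Fintype E] [Fintype E'] (F : Matrix E B ℂ)
    (L : Matrix E' B ℂ) (h : Fᴴ * F + Lᴴ * L = 1)
    {Λ : Matrix (A × E) (A × E) ℂ → Matrix (C × D) (C × D) ℂ}
    {Λ' : Matrix (A × E') (A × E') ℂ → Matrix (C × D) (C × D) ℂ}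
    (hΛ : IsLOCC Λ) (hΛ' : IsLOCC Λ') :
    IsLOCC fun X : Matrix (A × B) (A × B) ℂ =>
      Λ (((1 : Matrix A A ℂ) ⊗ₖ F) * X * ((1 : Matrix A A ℂ) ⊗ₖ F)ᴴ) +
      Λ' (((1 : Matrix A A ℂ) ⊗ₖ L) * X * ((1 : Matrix A A ℂ) ⊗ₖ L)ᴴ) := by
  let _ : ∀ i : Bool, Fintype (cond i E E') := fun i => by cases i <;> assumption
  have := IsLOCC.bob (A := A) (B := B) (ι := Bool) (E := fun i => cond i E E')
    (fun i => match i with | true => F | false => L)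
    (by rw [Fintype.sum_bool]; exact h)
    (fun i => match i with | true => Λ | false => Λ')
    (fun i => match i with | true => hΛ | false => hΛ')
  simp only [Fintype.sum_bool] at this
  exact this

theorem trace_conj_add_trace_conj {S E E' : Type} [Fintype S] [DecidableEq S] [Fintype E]
    [Fintype E'] {F : Matrix E S ℂ} {L : Matrix E' S ℂ} (h : Fᴴ * F + Lᴴ * L = 1)
    (X : Matrix S S ℂ) : (F * X * Fᴴ).trace + (L * X * Lᴴ).trace = X.trace := by
  rw [Matrix.trace_mul_comm, Matrix.trace_mul_comm (L * X), ← Matrix.mul_assoc,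
    ← Matrix.mul_assoc, ← Matrix.trace_add, ← Matrix.add_mul, h, Matrix.one_mul]

/-- Local filters `F` and `G`, with the state replaced by a classically correlated one whenever
one of the filters fails. -/
theorem isLOCC_filter {F : Matrix (Fin 2) A ℂ} {L : Matrix A A ℂ} (hF : Fᴴ * F + Lᴴ * L = 1)
    {G : Matrix (Fin 2) B ℂ} {M : Matrix B B ℂ} (hG : Gᴴ * G + Mᴴ * M = 1) :
    IsLOCC fun X : Matrix (A × B) (A × B) ℂ => (F ⊗ₖ G) * X * (F ⊗ₖ G)ᴴ +
      (X.trace - ((F ⊗ₖ G) * X * (F ⊗ₖ G)ᴴ).trace) • dephased 0 := by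
  have h := isLOCC_alice_two (B := B) F L hF
    (isLOCC_bob_two (A := Fin 2) G M hG IsLOCC.finish isLOCC_prepare) isLOCC_prepare
  convert h using 1
  funext X
  have hF' : (F ⊗ₖ (1 : Matrix B B ℂ))ᴴ * (F ⊗ₖ (1 : Matrix B B ℂ)) +
      (L ⊗ₖ (1 : Matrix B B ℂ))ᴴ * (L ⊗ₖ (1 : Matrix B B ℂ)) = 1 := by
    simp only [Matrix.conjTranspose_kronecker, ← Matrix.mul_kronecker_mul,
      Matrix.conjTranspose_one, Matrix.mul_one, ← Matrix.add_kronecker, hF,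
      Matrix.one_kronecker_one]
  have hG' : ((1 : Matrix (Fin 2) (Fin 2) ℂ) ⊗ₖ G)ᴴ * ((1 : Matrix (Fin 2) (Fin 2) ℂ) ⊗ₖ G) +
      ((1 : Matrix (Fin 2) (Fin 2) ℂ) ⊗ₖ M)ᴴ * ((1 : Matrix (Fin 2) (Fin 2) ℂ) ⊗ₖ M) = 1 := by
    simp only [Matrix.conjTranspose_kronecker, ← Matrix.mul_kronecker_mul,
      Matrix.conjTranspose_one, Matrix.mul_one, ← Matrix.kronecker_add, hG,
      Matrix.one_kronecker_one]
  -- The weights of the two failure branches, Alice's and then Bob's, add up to the trace missing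
  -- from the success branch.
  rw [← trace_conj_add_trace_conj hF' X, ← trace_conj_add_trace_conj hG', conj_bob_conj_alice]
  module

/-- The filter sending the basis vector `α i` to `f i` times the basis vector `i`. -/
def filter {A : Type} [DecidableEq A] (f : Fin 2 → ℂ) (α : Fin 2 → A) : Matrix (Fin 2) A ℂ :=
  Matrix.of fun i a => if α i = a then f i else 0

theorem filter_eq {A : Type} [Fintype A] [DecidableEq A] (f : Fin 2 → ℂ) (α : Fin 2 → A) :
    filter f α = Matrix.diagonal f * selection α := by
  ext i a
  simp [filter, selection, Matrix.one_apply]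

/-- A filter that rescales and relabels some basis vectors is part of a measurement. -/
theorem exists_complement {f : Fin 2 → ℂ} (hf : ∀ i, ‖f i‖ ≤ 1) {α : Fin 2 → A}
    (hα : Function.Injective α) :
    ∃ L : Matrix A A ℂ,
      (filter f α)ᴴ * filter f α + Lᴴ * L = 1 := by
  -- This is the diagonal of `(filter f α)ᴴ * filter f α`. By injectivity of `α` it has at most one
  -- term at each `a`, so it is bounded by one.
  set d : A → ℝ := fun a => ∑ i, if α i = a then ‖f i‖ ^ 2 else 0 with hd
  have hd1 : ∀ a, 0 ≤ 1 - d a := fun a => by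
    by_cases h : ∃ i, α i = a
    · obtain ⟨i, rfl⟩ := h
      simp only [hd, hα.eq_iff, Finset.sum_ite_eq', Finset.mem_univ, if_true]
      nlinarith [hf i, norm_nonneg (f i)]
    · push Not at h
      simp [hd, h]
  refine ⟨Matrix.diagonal fun a => ((√(1 - d a) : ℝ) : ℂ), ?_⟩
  rw [Matrix.diagonal_conjTranspose, Matrix.diagonal_mul_diagonal]
  ext a a'
  simp only [Matrix.add_apply, Matrix.mul_apply, Matrix.conjTranspose_apply, filter,
    Matrix.of_apply, Matrix.diagonal_apply, Matrix.one_apply, Pi.star_apply, RCLike.star_def,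
    Complex.conj_ofReal, ← Complex.ofReal_mul, Real.mul_self_sqrt (hd1 _)]
  by_cases h : a = a'
  · subst h
    simp only [if_true, hd, Complex.ofReal_sub, Complex.ofReal_one, Complex.ofReal_sum]
    have : ∀ i, (starRingEnd ℂ) (if α i = a then f i else 0) * (if α i = a then f i else 0)
        = ((if α i = a then ‖f i‖ ^ 2 else 0 : ℝ) : ℂ) := fun i => by
      split_ifs
      · simp [Complex.conj_mul']
      · simp
    simp only [this]
    ring
  · simp only [h, if_false, add_zero]
    refine Finset.sum_eq_zero fun i _ => ?_
    by_cases h1 : α i = a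
    · simp [h1, h]
    · simp [h1]

theorem filter_conj_apply (f : Fin 2 → ℂ) (α : Fin 2 → A) (β : Fin 2 → B)
    (X : Matrix (A × B) (A × B) ℂ) (x y : Fin 2 × Fin 2) :
    (filter f α ⊗ₖ filter 1 β * X * (filter f α ⊗ₖ filter 1 β)ᴴ) x y =
      f x.1 * star (f y.1) * X (α x.1, β x.2) (α y.1, β y.2) := by
  have h : filter f α ⊗ₖ filter 1 β * X * (filter f α ⊗ₖ filter 1 β)ᴴ =
      Matrix.diagonal (fun x : Fin 2 × Fin 2 => f x.1) *
        ((selection α ⊗ₖ selection β) * X * (selection α ⊗ₖ selection β)ᴴ) *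
        (Matrix.diagonal fun x : Fin 2 × Fin 2 => f x.1)ᴴ := by
    rw [filter_eq, filter_eq, Matrix.mul_kronecker_mul, Matrix.diagonal_kronecker_diagonal,
      Matrix.conjTranspose_mul]
    simp only [Pi.one_apply, mul_one, Matrix.mul_assoc]
  rw [h, conj_selection, Matrix.diagonal_conjTranspose, Matrix.mul_diagonal, Matrix.diagonal_mul,
    Matrix.submatrix_apply, Pi.star_apply]
  simp only [Prod.map]
  ring

theorem injective_pair {S : Type} {a a' : S} (h : a ≠ a') : Function.Injective ![a, a'] := by
  intro i j hij
  fin_cases i <;> fin_cases j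
  · rfl
  · exact absurd hij h
  · exact absurd hij h.symm
  · rfl

/-- A coherence between `|a b⟩` and `|a' b'⟩` with unpopulated partner levels can be turned by
LOCC into a phase-damped maximally entangled pair of qubits. -/
theorem exists_isLOCC_dephased {σ : Matrix (A × B) (A × B) ℂ} (hσ : IsState σ) {a a' : A}
    {b b' : B} (hc : σ (a, b) (a', b') ≠ 0) (h1 : σ (a, b') (a, b') = 0)
    (h2 : σ (a', b) (a', b) = 0) :
    ∃ t : ℝ, 0 < t ∧ t ≤ 1 ∧
      ∃ Λ : Matrix (A × B) (A × B) ℂ → Matrix (Fin 2 × Fin 2) (Fin 2 × Fin 2) ℂ,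
        IsLOCC Λ ∧ Λ σ = dephased t := by
  have hrow : ∀ x y, σ x x = 0 → σ x y = 0 := fun x y h => by
    have := PosSemidef.norm_sq_le hσ.posSemidef x y
    rw [h, Complex.zero_re, zero_mul] at this
    exact norm_eq_zero.mp (pow_eq_zero_iff two_ne_zero |>.mp (le_antisymm this (by positivity)))
  have hcol : ∀ x y, σ y y = 0 → σ x y = 0 := fun x y h => by
    rw [← hσ.posSemidef.isHermitian.apply, hrow y x h, star_zero]
  have ha : a ≠ a' := by rintro rfl; exact hc (hcol _ _ h1)
  have hb : b ≠ b' := by rintro rfl; exact hc (hrow _ _ h1)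
  have hdiag : ∀ x, σ x x = (((σ x x).re : ℝ) : ℂ) := fun x =>
    Complex.eq_re_of_ofReal_le (r := 0) (by simpa using hσ.posSemidef.diag_nonneg)
  have hnn : ∀ x, 0 ≤ (σ x x).re := fun x => (Complex.le_def.mp hσ.posSemidef.diag_nonneg).1
  set p := (σ (a, b) (a, b)).re with hp
  set q := (σ (a', b') (a', b')).re with hq
  set c := σ (a, b) (a', b') with hcdef
  have hcpos : 0 < ‖c‖ := norm_pos_iff.mpr hc
  have hcpq : ‖c‖ ^ 2 ≤ p * q := PosSemidef.norm_sq_le hσ.posSemidef _ _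
  have hpq : p + q ≤ 1 := by
    have h3 := congrArg Complex.re hσ.trace_eq_one
    rw [Matrix.trace, Complex.re_sum, Complex.one_re] at h3
    rw [← h3]
    exact Finset.add_le_sum (f := fun x => (σ.diag x).re) (fun x _ => hnn x) (Finset.mem_univ _)
      (Finset.mem_univ _) fun h => ha (Prod.mk.inj h).1
  have hp0 : 0 ≤ p := hnn _
  have hq0 : 0 ≤ q := hnn _
  have hpq0 : 0 < p * q := lt_of_lt_of_le (by positivity) hcpq
  -- The weights `√q`, `√p` bring both populations to `p q`; the phase `c / ‖c‖` makes the filtered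
  -- coherence the positive number `√(p q) ‖c‖`.
  set f : Fin 2 → ℂ := ![((√q : ℝ) : ℂ), ((√p : ℝ) : ℂ) * (c / ‖c‖)] with hf
  have hphase : ‖c / ‖c‖‖ = 1 := by
    rw [norm_div, Complex.norm_real, norm_norm, div_self hcpos.ne']
  have hf1 : ∀ i, ‖f i‖ ≤ 1 := by
    rw [Fin.forall_fin_two]
    have key : ∀ r : ℝ, r ≤ 1 → ‖((√r : ℝ) : ℂ)‖ ≤ 1 := fun r hr => by
      rw [Complex.norm_real, Real.norm_of_nonneg (Real.sqrt_nonneg _)]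
      exact Real.sqrt_le_one.mpr hr
    refine ⟨key q (by linarith), ?_⟩
    change ‖((√p : ℝ) : ℂ) * (c / ‖c‖)‖ ≤ 1
    rw [norm_mul, hphase, mul_one]
    exact key p (by linarith)
  have hα : Function.Injective ![a, a'] := injective_pair ha
  have hβ : Function.Injective ![b, b'] := injective_pair hb
  obtain ⟨L, hL⟩ := exists_complement hf1 hα
  obtain ⟨M, hM⟩ := exists_complement (f := 1) (by simp) hβ
  have hcs : ‖c‖ ≤ √(p * q) := Real.le_sqrt_of_sq_le hcpq
  have hss : √(p * q) * √(p * q) = p * q := Real.mul_self_sqrt hpq0.le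
  -- Failures top up each population `p q` to `1 / 2` and add no coherence, so `t / 2` is the
  -- filtered coherence. The bound on `t` is `t ≤ 2 p q ≤ (p + q) ^ 2 / 2`.
  refine ⟨2 * (√(p * q) * ‖c‖), by positivity, ?_, _, isLOCC_filter hL hM, ?_⟩
  · nlinarith [mul_le_mul_of_nonneg_left hcs (Real.sqrt_nonneg (p * q)), sq_nonneg (p - q)]
  have hf00 : f 0 * star (f 0) = q := by
    change ((√q : ℝ) : ℂ) * star ((√q : ℝ) : ℂ) = q
    rw [RCLike.star_def, Complex.conj_ofReal, ← Complex.ofReal_mul, Real.mul_self_sqrt hq0]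
  have hf11 : f 1 * star (f 1) = p := by
    rw [RCLike.star_def, Complex.mul_conj']
    change ((‖((√p : ℝ) : ℂ) * (c / ‖c‖)‖ : ℝ) : ℂ) ^ 2 = p
    rw [norm_mul, hphase, mul_one, Complex.norm_real, Real.norm_of_nonneg (Real.sqrt_nonneg _),
      ← Complex.ofReal_pow, Real.sq_sqrt hp0]
  have hf01 : f 0 * star (f 1) * c = ((√(p * q) * ‖c‖ : ℝ) : ℂ) := by
    change ((√q : ℝ) : ℂ) * star (((√p : ℝ) : ℂ) * (c / ‖c‖)) * c = _
    have hcn : ((‖c‖ : ℝ) : ℂ) ≠ 0 := by exact_mod_cast hcpos.ne'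
    have hcc : star c * c = (‖c‖ : ℂ) ^ 2 := by rw [RCLike.star_def, Complex.conj_mul']
    rw [star_mul', star_div₀, Real.sqrt_mul hp0]
    simp only [RCLike.star_def, Complex.conj_ofReal] at hcc ⊢
    push_cast
    field_simp
    linear_combination ((√q : ℝ) : ℂ) * ((√p : ℝ) : ℂ) * hcc
  have hf10 : f 1 * star (f 0) * star c = ((√(p * q) * ‖c‖ : ℝ) : ℂ) := by
    have := congrArg star hf01
    rw [star_mul', star_mul', star_star, RCLike.star_def, Complex.conj_ofReal] at this
    rw [← this, RCLike.star_def]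
    ring
  have hc' : σ (a', b') (a, b) = star c := (hσ.posSemidef.isHermitian.apply _ _).symm
  have htr : (filter f ![a, a'] ⊗ₖ filter 1 ![b, b'] * σ *
      (filter f ![a, a'] ⊗ₖ filter 1 ![b, b'])ᴴ).trace = 2 * (p * q) := by
    simp only [Matrix.trace, Matrix.diag_apply, filter_conj_apply, Fintype.sum_prod_type,
      Fin.sum_univ_two, Matrix.cons_val_zero, Matrix.cons_val_one, h1, h2, hf00, hf11]
    rw [hdiag (a, b), hdiag (a', b')]
    ring
  rw [htr, hσ.trace_eq_one]
  ext ⟨x, x'⟩ ⟨y, y'⟩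
  rw [Matrix.add_apply, filter_conj_apply]
  have e1 := hrow _ (a, b) h1
  have e2 := hrow _ (a', b') h1
  have e3 := hrow _ (a, b) h2
  have e4 := hrow _ (a', b') h2
  have e5 := hrow _ (a', b) h1
  have e6 := hrow _ (a, b') h2
  have e7 := hcol (a, b) _ h1
  have e8 := hcol (a', b') _ h1
  have e9 := hcol (a, b) _ h2
  have e10 := hcol (a', b') _ h2
  fin_cases x <;> fin_cases x' <;> fin_cases y <;> fin_cases y' <;>
    simp [dephased, h1, h2, e1, e2, e3, e4, e5, e6, e7, e8, e9, e10]
  · rw [← RCLike.star_def, hf00, hdiag (a, b)]; ring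
  · simpa using hf01
  · rw [hc']; simpa using hf10
  · rw [← RCLike.star_def, hf11, hdiag (a', b')]; ring

end Filter

/-! ### Errors in the complementary basis -/

/-- The state on `V ⊗ V` that is maximally entangled up to a random shift by `e : V`, which
occurs with probability `P e`. -/
def shiftMixture {V : Type} [Fintype V] [AddCommGroup V] [DecidableEq V] (P : V → ℝ) :
    Matrix (V × V) (V × V) ℂ :=
  Matrix.of fun x y =>
    if x.1 - x.2 = y.1 - y.2 then ((P (x.1 - x.2) / Fintype.card V : ℝ) : ℂ) else 0

theorem copies_shiftMixture {V : Type} [Fintype V] [AddCommGroup V] [DecidableEq V] (P : V → ℝ)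
    (n : ℕ) : copies (shiftMixture P) n = shiftMixture fun e : Fin n → V => ∏ i, P (e i) := by
  ext x y
  simp only [copies, shiftMixture, Matrix.of_apply, funext_iff, Pi.sub_apply]
  by_cases h : ∀ i, x.1 i - x.2 i = y.1 i - y.2 i
  · simp only [h, if_true, implies_true, Fintype.card_pi, Finset.prod_const]
    push_cast
    rw [Finset.prod_div_distrib]
    simp
  · rw [if_neg h]
    push Not at h
    obtain ⟨i, hi⟩ := h
    exact Finset.prod_eq_zero (Finset.mem_univ i) (if_neg hi)

/-- The probabilities of a bit staying the same or being flipped, with bias `t`. -/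
def flipProb (t : ℝ) (e : ZMod 2) : ℝ := if e = 0 then (1 + t) / 2 else (1 - t) / 2

/-- The Hadamard matrix. -/
def hadamard : Matrix (ZMod 2) (Fin 2) ℂ :=
  Matrix.of fun r i => ((√2 : ℝ) : ℂ)⁻¹ * if r = 1 ∧ i = 1 then -1 else 1

theorem univ_zmod_two : (Finset.univ : Finset (ZMod 2)) = {0, 1} := rfl

theorem conjTranspose_hadamard_mul : hadamardᴴ * hadamard = (1 : Matrix (Fin 2) (Fin 2) ℂ) := by
  have h := inv_sqrt_two_mul_self
  ext i j
  fin_cases i <;> fin_cases j <;>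
    simp [hadamard, Matrix.mul_apply, univ_zmod_two] <;>
    linear_combination 2 * h

/-- Phase damping mixes the Bell states `Φ⁺` and `Φ⁻` with weights `(1 ± t) / 2`. Two Hadamards fix
`Φ⁺` and send `Φ⁻` to `Φ⁺` with one bit flipped. -/
theorem hadamard_conj_dephased (t : ℝ) :
    (hadamard ⊗ₖ hadamard) * dephased t * (hadamard ⊗ₖ hadamard)ᴴ =
      shiftMixture (flipProb t) := by
  have hs := inv_sqrt_two_mul_self
  have hz : ∀ r : ZMod 2, r = 0 ∨ r = 1 := by decide
  ext ⟨x, x'⟩ ⟨y, y'⟩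
  set s := ((√2 : ℝ) : ℂ)⁻¹ with hsdef
  have h4 : s ^ 4 = 1 / 4 := by linear_combination (s * s + 1 / 2) * hs
  have hstar : (starRingEnd ℂ) s = s := by rw [hsdef, map_inv₀, Complex.conj_ofReal]
  rcases hz x with rfl | rfl <;> rcases hz x' with rfl | rfl <;> rcases hz y with rfl | rfl <;>
    rcases hz y' with rfl | rfl <;>
    simp [hadamard, dephased, shiftMixture, flipProb, Matrix.mul_apply, Fintype.sum_prod_type,
      Fin.sum_univ_two, ← hsdef, hstar] <;> ring_nf <;> (try rw [h4]) <;> ring_nf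

/-! ### Linear codes with few likely collisions -/

section Collision

variable {V : Type} [Fintype V] [AddCommGroup V]

open Classical in
/-- The weight of the pairs of distinct errors that the code `C` does not distinguish. -/
def collision (W : V → V → ℝ) (C : AddSubgroup V) : ℝ :=
  ∑ e, ∑ e', if e ≠ e' ∧ e - e' ∈ C then W e e' else 0

/-- Choosing the likeliest error of every coset of `C`, one is right up to the collision weight. -/
theorem exists_decoder {P : V → ℝ} (hP : ∀ e, 0 ≤ P e) (C : AddSubgroup V) [Fintype (V ⧸ C)] :
    ∃ s : V ⧸ C → V, (∀ q, (s q : V ⧸ C) = q) ∧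
      ∑ e, P e - collision (fun e e' => √(P e) * √(P e')) C ≤ ∑ q, P (s q) := by
  classical
  have hex : ∀ q : V ⧸ C, ∃ v : V, (v : V ⧸ C) = q ∧ ∀ e : V, (e : V ⧸ C) = q → P e ≤ P v := by
    intro q
    obtain ⟨v₀, hv₀⟩ := QuotientAddGroup.mk_surjective q
    obtain ⟨v, hv, hmax⟩ := Finset.exists_max_image
      (Finset.univ.filter fun v : V => (v : V ⧸ C) = q) P ⟨v₀, by simpa using hv₀⟩
    exact ⟨v, by simpa using hv, fun e he => hmax e (by simpa using he)⟩
  choose s hs hmax using hex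
  refine ⟨s, hs, ?_⟩
  have hW : ∀ e e', 0 ≤ √(P e) * √(P e') := fun e e' => by positivity
  -- A wrongly decoded `e` shares its coset with a representative at least as likely, so `P e` is at
  -- most the collision term of that pair.
  have hterm : ∀ e, P e ≤ (if e ∈ Finset.univ.image s then P e else 0) +
      ∑ e', if e ≠ e' ∧ e - e' ∈ C then √(P e) * √(P e') else 0 := by
    intro e
    have hnn : ∀ e' ∈ Finset.univ, (0 : ℝ) ≤
        if e ≠ e' ∧ e - e' ∈ C then √(P e) * √(P e') else 0 := fun e' _ => by
      split_ifs
      · exact hW _ _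
      · exact le_rfl
    by_cases h : e ∈ Finset.univ.image s
    · rw [if_pos h]
      exact le_add_of_nonneg_right (Finset.sum_nonneg hnn)
    · rw [if_neg h, zero_add]
      refine le_trans ?_ (Finset.single_le_sum hnn (Finset.mem_univ (s (e : V ⧸ C))))
      have h1 : e ≠ s (e : V ⧸ C) := fun he =>
        h (Finset.mem_image.mpr ⟨(e : V ⧸ C), Finset.mem_univ _, he.symm⟩)
      have h2 : e - s (e : V ⧸ C) ∈ C := by
        have := QuotientAddGroup.eq.mp (hs (e : V ⧸ C))
        rwa [neg_add_eq_sub] at this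
      rw [if_pos ⟨h1, h2⟩]
      calc P e = √(P e) * √(P e) := (Real.mul_self_sqrt (hP e)).symm
        _ ≤ √(P e) * √(P (s (e : V ⧸ C))) :=
          mul_le_mul_of_nonneg_left (Real.sqrt_le_sqrt (hmax _ e rfl)) (Real.sqrt_nonneg _)
  have hsum := Finset.sum_le_sum fun e (_ : e ∈ Finset.univ) => hterm e
  rw [Finset.sum_add_distrib, ← Finset.sum_filter, Finset.filter_mem_eq_inter,
    Finset.univ_inter, Finset.sum_image fun q _ q' _ h => by rw [← hs q, ← hs q', h]] at hsum
  rw [collision]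
  linarith

end Collision

/-- Adding to `h` the basis vector at a coordinate where `x` is `1` flips `h ⬝ᵥ x`, and so pairs
solutions with non-solutions. -/
theorem sum_dotProduct_eq_zero {n : ℕ} {x : Fin n → ZMod 2} (hx : x ≠ 0) :
    2 * ∑ h : Fin n → ZMod 2, (if h ⬝ᵥ x = 0 then (1 : ℝ) else 0) = (2 : ℝ) ^ n := by
  obtain ⟨i, hi⟩ := Function.ne_iff.mp hx
  have hz : ∀ r : ZMod 2, r ≠ 0 → r = 1 := by decide
  have hi1 : x i = 1 := hz _ hi
  have h1 : ∑ h : Fin n → ZMod 2, (if (h + Pi.single i 1) ⬝ᵥ x = 0 then (1 : ℝ) else 0) =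
      ∑ h : Fin n → ZMod 2, if h ⬝ᵥ x = 0 then (1 : ℝ) else 0 :=
    Equiv.sum_comp (Equiv.addRight (Pi.single i 1 : Fin n → ZMod 2))
    fun h : Fin n → ZMod 2 => if h ⬝ᵥ x = 0 then (1 : ℝ) else 0
  have h2 : ∀ h : Fin n → ZMod 2, (if h ⬝ᵥ x = 0 then (1 : ℝ) else 0) +
      (if (h + Pi.single i 1) ⬝ᵥ x = 0 then (1 : ℝ) else 0) = 1 := fun h => by
    rw [add_dotProduct, single_dotProduct, hi1, one_mul]
    have h3 : ∀ r : ZMod 2, (if r = 0 then (1 : ℝ) else 0) + (if r + 1 = 0 then 1 else 0) = 1 := by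
      intro r
      by_cases hr : r = 0
      · subst hr; norm_num
      · rw [hz r hr]
        have : (1 : ZMod 2) + 1 = 0 := by decide
        simp [this]
    exact h3 _
  have h4 := Finset.sum_congr (rfl : Finset.univ = Finset.univ) fun h _ => h2 h
  rw [Finset.sum_add_distrib] at h4
  rw [h1] at h4
  rw [two_mul, h4]
  simp

/-- A further parity check at least halves the collision weight, and at most halves the code. -/
theorem exists_halving {n : ℕ} {W : (Fin n → ZMod 2) → (Fin n → ZMod 2) → ℝ}
    (C : AddSubgroup (Fin n → ZMod 2)) :
    ∃ C' : AddSubgroup (Fin n → ZMod 2), Nat.card C ≤ 2 * Nat.card C' ∧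
      2 * collision W C' ≤ collision W C := by
  classical
  set φ : (Fin n → ZMod 2) → (Fin n → ZMod 2) →+ ZMod 2 := fun h =>
    AddMonoidHom.mk' (fun x => h ⬝ᵥ x) (dotProduct_add h) with hφ
  have hcard : ∀ h, Nat.card C ≤ 2 * Nat.card (C ⊓ (φ h).ker : AddSubgroup _) := fun h => by
    have h1 := AddSubgroup.relIndex_mul_relIndex ⊥ (C ⊓ (φ h).ker) C bot_le inf_le_left
    rw [AddSubgroup.relIndex_bot_left, AddSubgroup.relIndex_bot_left,
      AddSubgroup.inf_relIndex_left, AddSubgroup.relIndex_ker] at h1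
    rw [← h1, mul_comm]
    refine Nat.mul_le_mul_right _ ?_
    have := Nat.card_le_card_of_injective (Subtype.val : AddSubgroup.map (φ h) C → ZMod 2)
      Subtype.val_injective
    simpa using this
  -- Each colliding pair survives exactly half of all checks `h`, so some `h` does at least as well
  -- as the average.
  have havg : ∑ h, 2 * collision W (C ⊓ (φ h).ker) = ∑ _h : Fin n → ZMod 2, collision W C := by
    rw [← Finset.mul_sum]
    simp only [collision]
    rw [Finset.sum_comm, Finset.mul_sum, Finset.sum_const, nsmul_eq_mul, Finset.mul_sum]
    refine Finset.sum_congr rfl fun e _ => ?_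
    rw [Finset.sum_comm, Finset.mul_sum, Finset.mul_sum]
    refine Finset.sum_congr rfl fun e' _ => ?_
    by_cases hC : e ≠ e' ∧ e - e' ∈ C
    · rw [if_pos hC]
      refine (congrArg (2 * ·) (Finset.sum_congr rfl (fun h _ => ?_) : _ =
        ∑ h : Fin n → ZMod 2, (if h ⬝ᵥ (e - e') = 0 then (1 : ℝ) else 0) * W e e')).trans ?_
      · by_cases hh : h ⬝ᵥ (e - e') = 0
        · rw [if_pos hh, one_mul]
          exact if_pos ⟨hC.1, AddSubgroup.mem_inf.mpr ⟨hC.2, hh⟩⟩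
        · rw [if_neg hh, zero_mul]
          exact if_neg fun h' => hh (AddSubgroup.mem_inf.mp h'.2).2
      rw [← Finset.sum_mul, ← mul_assoc, sum_dotProduct_eq_zero (sub_ne_zero.mpr hC.1)]
      simp
    · rw [if_neg hC, mul_zero, Finset.sum_eq_zero, mul_zero]
      intro h _
      exact if_neg fun hh => hC ⟨hh.1, (AddSubgroup.mem_inf.mp hh.2).1⟩
  obtain ⟨h, -, hh⟩ := Finset.exists_le_of_sum_le Finset.univ_nonempty havg.le
  exact ⟨_, hcard h, hh⟩

theorem exists_code {n : ℕ} (W : (Fin n → ZMod 2) → (Fin n → ZMod 2) → ℝ) (m : ℕ) :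
    ∃ C : AddSubgroup (Fin n → ZMod 2), 2 ^ n ≤ 2 ^ m * Nat.card C ∧
      2 ^ m * collision W C ≤ collision W ⊤ := by
  induction m with
  | zero => exact ⟨⊤, by simp, by simp⟩
  | succ m ih =>
    obtain ⟨C, h1, h2⟩ := ih
    obtain ⟨C', h3, h4⟩ := exists_halving (W := W) C
    refine ⟨C', ?_, ?_⟩
    · calc 2 ^ n ≤ 2 ^ m * Nat.card C := h1
        _ ≤ 2 ^ m * (2 * Nat.card C') := Nat.mul_le_mul_left _ h3
        _ = 2 ^ (m + 1) * Nat.card C' := by ring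
    · calc 2 ^ (m + 1) * collision W C' = 2 ^ m * (2 * collision W C') := by ring
        _ ≤ 2 ^ m * collision W C := by gcongr
        _ ≤ _ := h2

/-! ### Distillation with a code -/

theorem maxEntangledFidelity_eq {K : ℕ} (σ : Matrix (Fin K × Fin K) (Fin K × Fin K) ℂ) :
    maxEntangledFidelity σ = (K : ℝ)⁻¹ * ∑ i, ∑ j, (σ (i, i) (j, j)).re := by
  have hK : (√(K : ℝ))⁻¹ * (√(K : ℝ))⁻¹ = (K : ℝ)⁻¹ := by
    rw [← mul_inv, Real.mul_self_sqrt (Nat.cast_nonneg K)]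
  have hstar : ∀ p : Prop, [Decidable p] → ∀ z : ℝ, star (if p then (z : ℂ) else 0) =
      if p then (z : ℂ) else 0 := fun p _ z => by split_ifs <;> simp
  simp only [maxEntangledFidelity, dotProduct, Matrix.mulVec, maxEntangled, Pi.star_apply,
    Fintype.sum_prod_type, hstar, mul_ite, ite_mul, mul_zero, zero_mul, Finset.sum_ite_eq,
    Finset.mem_univ, if_true, Complex.re_sum, ← Finset.sum_mul]
  simp only [Complex.re_ofReal_mul, Complex.re_sum, Complex.re_mul_ofReal, Finset.mul_sum, ← hK]
  refine Finset.sum_congr rfl fun i _ => ?_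
  rw [← Finset.mul_sum]
  ring

section Hashing

variable {V : Type} [Fintype V] [AddCommGroup V] [DecidableEq V]

/-- Alice projects onto a random translate of the code, and Bob measures the coset of the shift
and undoes its likeliest value. -/
theorem exists_isLOCC_hashing (P : V → ℝ) (C : AddSubgroup V) [Fintype (V ⧸ C)] (s : V ⧸ C → V)
    (hs : ∀ q, (s q : V ⧸ C) = q) :
    ∃ Λ : Matrix (V × V) (V × V) ℂ →
        Matrix (Fin (Nat.card C) × Fin (Nat.card C)) (Fin (Nat.card C) × Fin (Nat.card C)) ℂ,
      IsLOCC Λ ∧ maxEntangledFidelity (Λ (shiftMixture P)) = ∑ q, P (s q) := by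
  set K := Nat.card C with hKdef
  have hK : 0 < K := Nat.card_pos
  have hK' : (K : ℝ) ≠ 0 := by exact_mod_cast hK.ne'
  have hV' : (Fintype.card V : ℝ) ≠ 0 := by exact_mod_cast Fintype.card_ne_zero
  let ε : Fin K ≃ C := (Finite.equivFin C).symm
  have hzz : star (((√(K : ℝ))⁻¹ : ℝ) : ℂ) * (((√(K : ℝ))⁻¹ : ℝ) : ℂ) = (((K : ℝ)⁻¹ : ℝ) : ℂ) := by
    rw [RCLike.star_def, Complex.conj_ofReal, ← Complex.ofReal_mul, ← mul_inv,
      Real.mul_self_sqrt (Nat.cast_nonneg K)]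
  set z : ℂ := (((√(K : ℝ))⁻¹ : ℝ) : ℂ) with hz
  -- Each element of `V` is `ε j + v` for exactly `K` pairs `(j, v)`, which the weight `1 / K`
  -- compensates.
  have hA : ∑ v : V, (z • selection fun j : Fin K => (ε j : V) + v)ᴴ *
      (z • selection fun j : Fin K => (ε j : V) + v) = 1 := by
    simp only [Matrix.conjTranspose_smul, Matrix.smul_mul, Matrix.mul_smul, smul_smul,
      conjTranspose_selection_mul, mul_comm z, hzz, ← Finset.smul_sum]
    rw [Finset.sum_comm]
    have : ∀ j : Fin K, ∑ v : V, Matrix.single ((ε j : V) + v) ((ε j : V) + v) (1 : ℂ) = 1 :=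
      fun j => (Equiv.sum_comp (Equiv.addLeft (ε j : V)) fun v => Matrix.single v v (1 : ℂ)).trans
        sum_single_one
    simp only [this, Finset.sum_const, Finset.card_univ, Fintype.card_fin]
    rw [← Nat.cast_smul_eq_nsmul ℂ, smul_smul]
    have : (((K : ℝ)⁻¹ : ℝ) : ℂ) * (K : ℂ) = 1 := by
      rw [← Complex.ofReal_natCast, ← Complex.ofReal_mul, inv_mul_cancel₀ hK', Complex.ofReal_one]
    rw [this, one_smul]
  -- Since `s` picks one element per coset, `(q, j) ↦ ε j + v - s q` is a bijection onto `V`.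
  have hB : ∀ v : V, ∑ q : V ⧸ C, (selection fun j : Fin K => (ε j : V) + v - s q)ᴴ *
      (selection fun j : Fin K => (ε j : V) + v - s q) = 1 := by
    intro v
    simp only [conjTranspose_selection_mul]
    rw [← Fintype.sum_prod_type'
      (f := fun (q : V ⧸ C) (j : Fin K) => Matrix.single ((ε j : V) + v - s q)
        ((ε j : V) + v - s q) (1 : ℂ))]
    have hbij : Function.Bijective fun y : (V ⧸ C) × Fin K => (ε y.2 : V) + v - s y.1 := by
      constructor
      · rintro ⟨q, j⟩ ⟨q', j'⟩ h
        have h1 : (ε j : V) - (ε j' : V) = s q - s q' := by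
          have h2 : (ε j : V) + v - s q = (ε j' : V) + v - s q' := h
          rw [sub_eq_sub_iff_add_eq_add] at h2 ⊢
          have h3 : (ε j : V) + s q' + v = s q + (ε j' : V) + v := by
            calc (ε j : V) + s q' + v = (ε j : V) + v + s q' := by abel
              _ = (ε j' : V) + v + s q := h2
              _ = _ := by abel
          exact add_right_cancel h3
        have hq : q = q' := by
          rw [← hs q, ← hs q']
          refine (QuotientAddGroup.eq.mpr ?_).symm
          rw [neg_add_eq_sub, ← h1]
          exact C.sub_mem (ε j).2 (ε j').2
        subst hq
        rw [sub_self, sub_eq_zero] at h1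
        rw [ε.injective (Subtype.ext h1)]
      · intro x
        have hmem : x - v + s ((v - x : V) : V ⧸ C) ∈ C := by
          have := QuotientAddGroup.eq.mp (hs ((v - x : V) : V ⧸ C)).symm
          rwa [neg_sub] at this
        refine ⟨(((v - x : V) : V ⧸ C), ε.symm ⟨_, hmem⟩), ?_⟩
        simp only [Equiv.apply_symm_apply]
        abel
    rw [hbij.sum_comp (fun x => Matrix.single x x (1 : ℂ)), sum_single_one]
  refine ⟨_, IsLOCC.alice (A := V) (B := V) (ι := V) (E := fun _ => Fin K)
    (fun v => z • selection fun j : Fin K => (ε j : V) + v) hA _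
    fun v => IsLOCC.bob (ι := V ⧸ C) (E := fun _ => Fin K)
      (fun q => selection fun j : Fin K => (ε j : V) + v - s q) (hB v) (fun _ X => X)
      fun _ => IsLOCC.finish, ?_⟩
  -- The selected labels of Alice and Bob differ by `s q` for every `i`, so only the error `s q`
  -- contributes.
  have hterm : ∀ (v : V) (q : V ⧸ C) (i j : Fin K),
      (((z • selection fun j : Fin K => (ε j : V) + v) ⊗ₖ
        (selection fun j : Fin K => (ε j : V) + v - s q)) * shiftMixture P *
        ((z • selection fun j : Fin K => (ε j : V) + v) ⊗ₖ
        (selection fun j : Fin K => (ε j : V) + v - s q))ᴴ) (i, i) (j, j) =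
      (((K : ℝ)⁻¹ * (P (s q) / Fintype.card V) : ℝ) : ℂ) := by
    intro v q i j
    rw [Matrix.smul_kronecker, Matrix.conjTranspose_smul, Matrix.smul_mul, Matrix.smul_mul,
      Matrix.mul_smul, smul_smul, conj_selection, mul_comm z, hzz]
    simp [shiftMixture]
  simp only [conj_bob_conj_alice]
  rw [maxEntangledFidelity_eq]
  simp only [Matrix.sum_apply, hterm, ← Complex.ofReal_sum, Complex.ofReal_re]
  simp only [Finset.sum_const,
    Finset.card_univ, Fintype.card_fin, nsmul_eq_mul, ← Finset.mul_sum, ← Finset.sum_div]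
  field_simp

end Hashing

/-! ### Error exponent and rate -/

theorem flipProb_nonneg {t : ℝ} (h0 : 0 ≤ t) (h1 : t ≤ 1) (e : ZMod 2) : 0 ≤ flipProb t e := by
  rw [flipProb]
  split_ifs <;> linarith

theorem sum_flipProb (t : ℝ) : ∑ e, flipProb t e = 1 := by
  rw [univ_zmod_two, Finset.sum_pair (by decide)]
  simp only [flipProb, if_true, one_ne_zero, if_false]
  ring

theorem sum_sqrt_flipProb_sq {t : ℝ} (h0 : 0 ≤ t) (h1 : t ≤ 1) :
    (∑ e, √(flipProb t e)) ^ 2 = 1 + √(1 - t ^ 2) := by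
  rw [univ_zmod_two, Finset.sum_pair (by decide), add_sq,
    Real.sq_sqrt (flipProb_nonneg h0 h1 0), Real.sq_sqrt (flipProb_nonneg h0 h1 1),
    mul_assoc, ← Real.sqrt_mul (flipProb_nonneg h0 h1 0)]
  simp only [flipProb, if_true, one_ne_zero, if_false]
  have : (1 + t) / 2 * ((1 - t) / 2) = (1 - t ^ 2) / 2 ^ 2 := by ring
  rw [this, Real.sqrt_div' _ (by norm_num), Real.sqrt_sq (by norm_num)]
  ring

/-- From `n` phase-damped pairs one obtains `k` ebits with an error of at most `2 ^ k μ ^ n`. -/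
theorem exists_isLOCC_copies_shiftMixture {t : ℝ} (h0 : 0 ≤ t) (h1 : t ≤ 1) {n k : ℕ}
    (hk : k ≤ n) :
    ∃ K : ℕ, 2 ^ k ≤ K ∧
      ∃ Λ : Matrix ((Fin n → ZMod 2) × (Fin n → ZMod 2)) ((Fin n → ZMod 2) × (Fin n → ZMod 2)) ℂ →
          Matrix (Fin K × Fin K) (Fin K × Fin K) ℂ,
        IsLOCC Λ ∧ 1 - 2 ^ k * ((1 + √(1 - t ^ 2)) / 2) ^ n ≤
          maxEntangledFidelity (Λ (copies (shiftMixture (flipProb t)) n)) := by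
  classical
  set P : (Fin n → ZMod 2) → ℝ := fun e => ∏ i, flipProb t (e i) with hP
  have hP0 : ∀ e, 0 ≤ P e := fun e => Finset.prod_nonneg fun i _ => flipProb_nonneg h0 h1 _
  have hP1 : ∑ e, P e = 1 := by
    rw [hP, ← Fintype.sum_pow, sum_flipProb, one_pow]
  -- Using `n - k` checks leaves at least `2 ^ k` codewords and divides the collision weight by `2 ^
  -- (n - k)`.
  obtain ⟨C, hC, hcol⟩ := exists_code (fun e e' => √(P e) * √(P e')) (n - k)
  obtain ⟨s, hs, hdec⟩ := exists_decoder hP0 C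
  obtain ⟨Λ, hΛ, hfid⟩ := exists_isLOCC_hashing P C s hs
  refine ⟨Nat.card C, ?_, Λ, hΛ, ?_⟩
  · refine Nat.le_of_mul_le_mul_left ?_ (pow_pos two_pos (n - k))
    rwa [← pow_add, Nat.sub_add_cancel hk]
  · rw [copies_shiftMixture, hfid]
    refine le_trans ?_ hdec
    rw [hP1]
    -- Dropping the restrictions on the pairs leaves `(∑ e, √(P e)) ^ 2`, which factorizes over the
    -- copies.
    have htop : collision (fun e e' => √(P e) * √(P e')) ⊤ ≤ (1 + √(1 - t ^ 2)) ^ n := by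
      have hsqrt : ∀ e, √(P e) = ∏ i, √(flipProb t (e i)) := fun e =>
        Real.sqrt_prod _ fun i _ => flipProb_nonneg h0 h1 _
      rw [← sum_sqrt_flipProb_sq h0 h1, ← pow_mul, mul_comm, pow_mul, Fintype.sum_pow, sq,
        Finset.sum_mul_sum]
      refine Finset.sum_le_sum fun e _ => Finset.sum_le_sum fun e' _ => ?_
      rw [← hsqrt, ← hsqrt]
      split_ifs
      · exact le_rfl
      · positivity
    have hpow : (2 : ℝ) ^ n = 2 ^ (n - k) * 2 ^ k := by
      rw [← pow_add, Nat.sub_add_cancel hk]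
    have h2 := hcol.trans htop
    rw [div_pow, hpow]
    have h3 : (2 : ℝ) ^ k * ((1 + √(1 - t ^ 2)) ^ n / (2 ^ (n - k) * 2 ^ k)) =
        (1 + √(1 - t ^ 2)) ^ n / 2 ^ (n - k) := by
      field_simp
    rw [h3]
    refine sub_le_sub_left ?_ 1
    rw [le_div_iff₀ (by positivity), mul_comm]
    exact h2

/-- A state that LOCC turns into a phase-damped, but not fully dephased, pair of qubits is
distillable. -/
theorem isDistillable_of_dephased {A B : Type} [Fintype A] [Fintype B]
    {ρ : Matrix (A × B) (A × B) ℂ} {t : ℝ} (h0 : 0 < t) (h1 : t ≤ 1)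
    {Λ : Matrix (A × B) (A × B) ℂ → Matrix (Fin 2 × Fin 2) (Fin 2 × Fin 2) ℂ} (hΛ : IsLOCC Λ)
    (hρ : Λ ρ = dephased t) : IsDistillable ρ := by
  have hH := (isLOCC_conj hadamard conjTranspose_hadamard_mul hadamard
    conjTranspose_hadamard_mul).comp hΛ
  set μ := (1 + √(1 - t ^ 2)) / 2 with hμ
  have hμ1 : μ < 1 := by
    have : √(1 - t ^ 2) < 1 := by
      rw [Real.sqrt_lt' one_pos]; nlinarith
    rw [hμ]; linarith
  have hμ0 : 1 / 2 ≤ μ := by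
    have := Real.sqrt_nonneg (1 - t ^ 2)
    rw [hμ]; linarith
  -- In `μ = r * r` one factor pays for the `2 ^ (R n) = r⁻¹ ^ n` codewords and the other makes the
  -- error decay.
  set r := √μ with hr
  have hr2 : r * r = μ := Real.mul_self_sqrt (by linarith)
  have hr0 : 0 < r := Real.sqrt_pos.mpr (by linarith)
  have hr1 : r < 1 := by rw [hr, Real.sqrt_lt' one_pos]; simpa using hμ1
  have hrhalf : 1 / 2 ≤ r := by nlinarith
  set R := -Real.logb 2 r with hR
  have h2R : (2 : ℝ) ^ R = r⁻¹ := by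
    rw [hR, Real.rpow_neg (by norm_num), Real.rpow_logb (by norm_num) (by norm_num) hr0]
  have hR0 : 0 < R := neg_pos.mpr (Real.logb_neg (by norm_num) hr0 hr1)
  -- This ensures that `⌈R n⌉₊ ≤ n`, as the code construction requires.
  have hR1 : R ≤ 1 := by
    have : Real.logb 2 (1 / 2) ≤ Real.logb 2 r :=
      Real.logb_le_logb_of_le (by norm_num) (by norm_num) hrhalf
    rw [one_div, Real.logb_inv, Real.logb_self_eq_one (by norm_num)] at this
    linarith
  refine ⟨R, hR0, fun ε hε => ?_⟩
  have hlim : Filter.Tendsto (fun n : ℕ => 2 * r ^ n) Filter.atTop (nhds 0) := by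
    simpa using (tendsto_pow_atTop_nhds_zero_of_lt_one hr0.le hr1).const_mul 2
  filter_upwards [hlim.eventually (gt_mem_nhds hε)] with n hn
  have hRn : 0 ≤ R * n := by positivity
  have hk : ⌈R * n⌉₊ ≤ n := Nat.ceil_le.mpr (by nlinarith [(Nat.cast_nonneg n : (0 : ℝ) ≤ n)])
  obtain ⟨Λn, hΛn, hcop⟩ := hH.copies ρ n
  obtain ⟨K, hK, Λ', hΛ', hfid⟩ := exists_isLOCC_copies_shiftMixture h0.le h1 hk
  have hle : (2 : ℝ) ^ (R * n) ≤ 2 ^ ⌈R * n⌉₊ := by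
    rw [← Real.rpow_natCast]
    exact Real.rpow_le_rpow_of_exponent_le (by norm_num) (Nat.le_ceil _)
  refine ⟨K, hle.trans (by exact_mod_cast hK), _, hΛ'.comp hΛn, ?_⟩
  rw [hcop, hρ, hadamard_conj_dephased]
  refine le_trans ?_ hfid
  -- Rounding up costs at most the factor `2`.
  have hup : (2 : ℝ) ^ ⌈R * n⌉₊ ≤ 2 * (r⁻¹) ^ n := by
    have h3 : (2 : ℝ) ^ (R * n + 1) = 2 * (r⁻¹) ^ n := by
      rw [Real.rpow_add two_pos, Real.rpow_one, Real.rpow_mul two_pos.le, h2R, Real.rpow_natCast,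
        mul_comm]
    rw [← h3, ← Real.rpow_natCast]
    exact Real.rpow_le_rpow_of_exponent_le (by norm_num) (Nat.ceil_lt_add_one hRn).le
  have hfin : (2 : ℝ) ^ ⌈R * n⌉₊ * μ ^ n ≤ 2 * r ^ n := by
    calc (2 : ℝ) ^ ⌈R * n⌉₊ * μ ^ n ≤ 2 * (r⁻¹) ^ n * μ ^ n :=
          mul_le_mul_of_nonneg_right hup (pow_nonneg (by linarith) n)
      _ = 2 * r ^ n := by
          rw [mul_assoc, ← mul_pow, ← hr2, inv_mul_cancel_left₀ hr0.ne']
  linarith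

end

end Bipartite

theorem mainTheorem5 {A B : Type} [Fintype A] [Fintype B] [DecidableEq A] [DecidableEq B]
    (ρ : Matrix (A × B) (A × B) ℂ) (hpair : Bipartite.IsPairing ρ)
    (hent : Bipartite.IsEntangled ρ) :
    Bipartite.IsNPT ρ ∧ Bipartite.IsDistillable ρ := by
  obtain ⟨UA, hA, UB, hB, a, a', b, b', hc, h1, h2⟩ := Bipartite.exists_coherence hpair hent
  constructor
  · intro hpos
    have hX := hpos.mul_mul_conjTranspose_same (UA.map star ⊗ₖ UB)
    rw [← Bipartite.partialTransposeA_conj] at hX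
    -- On these two levels the first diagonal entry is zero while the off-diagonal entry is the
    -- coherence.
    have h := Bipartite.PosSemidef.norm_sq_le hX (a', b) (a, b')
    have h0 : Bipartite.partialTransposeA ((UA ⊗ₖ UB) * ρ * (UA ⊗ₖ UB)ᴴ) (a', b) (a', b) = 0 := h2
    rw [h0, Complex.zero_re, zero_mul] at h
    exact hc (norm_eq_zero.mp ((pow_eq_zero_iff two_ne_zero).mp (le_antisymm h (by positivity))))
  · have hσ := Bipartite.isState_conj hpair.1 (Bipartite.kronecker_mem_unitaryGroup hA hB)
    obtain ⟨t, ht0, ht1, Λ, hΛ, hΛσ⟩ := Bipartite.exists_isLOCC_dephased hσ hc h1 h2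
    exact Bipartite.isDistillable_of_dephased ht0 ht1
      (hΛ.comp (Bipartite.isLOCC_conj UA (Matrix.mem_unitaryGroup_iff'.mp hA) UB
        (Matrix.mem_unitaryGroup_iff'.mp hB))) hΛσ
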